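/- Let $k\ge 0$ and $0<N\le 2k+3$ be integers ($N=N_f$), $d=2N$, and let $\gamma_1,\dots,\gamma_d$ be the gamma matrices of $SO(2N)$, $\{\gamma_i,\gamma_j\}=2\delta_{ij}$, acting on the $2^N$-dimensional complex space of spinors (in the oscillator basis, as tensor products of Pauli matrices). Let $B$ be an invertible matrix and $\epsilon=\pm1$ with $B\gamma_i=\epsilon\,\gamma_i^tB$ for all $i$; write $\eta^{\rm c}=\eta^tB$ and $\eta_1\cdot\eta_2=\eta_1^{\rm c}\eta_2$. Let $c\in\mathbb C$ with $c^2=(-1)^N$, and let $\gamma=c\,\gamma_1\cdots\gamma_d$. A spinor $\eta$ is pure if $\{v\in\mathbb C^d: v^i\gamma_i\eta=0\}$ has dimension $N$ (so $\eta\ne0$). Let $I,\tilde I$ be pure spinors with $\gamma I=I$ and $\gamma\tilde I=(-1)^N\tilde I$. Let $\Phi$ be the polyform that corresponds to the bispinor $I\otimes\tilde I^{\rm c}$ under the Clifford map $dx^{i_1}\wedge\cdots\wedge dx^{i_q}\mapsto\gamma^{i_1\dots i_q}$ (antisymmetrised product), let $\Phi_p$ be its $p$-form part, and let the type $t(I,\tilde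 I)$ be the lowest $p$ with $\Phi_p\neq0$. Let $*$ be the complex-linear Euclidean Hodge star, with $dx^J\wedge *dx^J=dx^1\wedge\cdots\wedge dx^d$ for every multi-index $J$, and put $\eta_1\cdot\gamma_{(q)}\eta_2=\frac1{q!}(\eta_1\cdot\gamma_{i_1\dots i_q}\eta_2)\,dx^{i_1}\wedge\dots\wedge dx^{i_q}$. Let $S\in\mathbb C$, let $(M_{ij})$ be a complex antisymmetric $d\times d$ matrix, $M=\frac12M_{ij}\,dx^i\wedge dx^j$, and let $\wedge^qM$ be the $q$-th wedge power of $M$. (a) If $S\neq0$, then $\Phi=S^{k+1}\exp(M/S)$ if and only if $\Phi_0=S^{k+1}$ and $\Phi_2=S^kM$. (b) Suppose that $\Phi=S^{k+1}\exp(M/S)$. For $S=0$ this identity is understood degree by degree, in the degrees where the right-hand side is polynomial in $S$: $\Phi_{2q}=\frac1{q!}S^{k+1-q}\wedge^qM$ for $0\le q\le k+1$, with $0^0=1$. Then: 1. $M^2=S^2\mathbb 1$ (matrix square). 2. $(S\delta_{ij}-M_{ij})\gamma^jI=0$ and $(S\delta_{ij}+M_{ij})\gamma^j\tilde I=0$ for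 every $i$. 3. For every $0\le q\le N$: $\ \frac1{q!}*\wedge^qM=c^{-1}(-1)^q\,S^{2q-N}\,\frac1{(N-q)!}\wedge^{N-q}M$. If $2q<N$, this is understood with the power of $S$ on the left: $\frac1{q!}S^{N-2q}*\wedge^qM=c^{-1}(-1)^q\frac1{(N-q)!}\wedge^{N-q}M$. 4. For every $q\ge0$: $\ \tilde I\cdot\gamma_{(2q)}I=(-1)^q\,2^N\,\frac1{q!}\,S^{k+1-q}\wedge^qM$. If $q>k+1$, this is understood with the power of $S$ on the left: $S^{q-k-1}\,\tilde I\cdot\gamma_{(2q)}I=(-1)^q2^N\frac1{q!}\wedge^qM$ (so $\wedge^qM=0$ for $q>k+1$ when $S=0$). 5. If $S\ne0$, then $t(I,\tilde I)=0$. -/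

import Mathlib

open scoped Matrix

noncomputable section

/-! ## Gamma matrices and spinors of `SO(2N)` in the oscillator basis -/

/-- Complex vectors in dimension `d = 2N`; the coordinate covectors `dx^i` are identified with
the standard basis through the Euclidean metric. -/
abbrev Vec (N : ℕ) : Type := Fin (2 * N) → ℂ

/-- Labels `|s₁ … s_N⟩` of the oscillator basis, `0` standing for `+` and `1` for `-`. -/
abbrev Signs (N : ℕ) : Type := Fin N → Fin 2

/-- Dirac spinors, a complex space of dimension `2 ^ N`. -/
abbrev Spinor (N : ℕ) : Type := Signs N → ℂ

/-- Endomorphisms of the space of spinors, that is, bispinors. -/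
abbrev SpinMat (N : ℕ) : Type := Matrix (Signs N) (Signs N) ℂ

/-- The Pauli matrix `σ₁`. -/
def pauli1 : Matrix (Fin 2) (Fin 2) ℂ := !![0, 1; 1, 0]
/-- The Pauli matrix `σ₂`. -/
def pauli2 : Matrix (Fin 2) (Fin 2) ℂ := !![0, -Complex.I; Complex.I, 0]
/-- The Pauli matrix `σ₃`. -/
def pauli3 : Matrix (Fin 2) (Fin 2) ℂ := !![1, 0; 0, -1]

/-- The `b`-th tensor factor of the `i`-th gamma matrix. -/
def gammaFactor {N : ℕ} (i : Fin (2 * N)) (b : Fin N) : Matrix (Fin 2) (Fin 2) ℂ :=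
  if b.val < i.val / 2 then pauli3
  else if b.val = i.val / 2 then (if i.val % 2 = 0 then pauli1 else pauli2)
  else 1

/-- The gamma matrices `σ₃ ⊗ ⋯ ⊗ σ₃ ⊗ σ_{1,2} ⊗ 1 ⊗ ⋯ ⊗ 1`. -/
def gamma {N : ℕ} (i : Fin (2 * N)) : SpinMat N :=
  fun s t => ∏ b, gammaFactor i b (s b) (t b)

/-- The Clifford action `v ↦ v^i γ_i` of a vector. -/
def gammaVec (N : ℕ) : Vec N →ₗ[ℂ] SpinMat N :=
  Fintype.linearCombination ℂ (gamma (N := N))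

theorem gamma_mul_apply {N : ℕ} (i j : Fin (2 * N)) (s t : Signs N) :
    (gamma i * gamma j) s t = ∏ b, (gammaFactor i b * gammaFactor j b) (s b) (t b) := by
  simp only [gamma, Matrix.mul_apply, ← Finset.prod_mul_distrib]
  rw [Finset.prod_univ_sum]
  simp

theorem gamma_sq {N : ℕ} (i : Fin (2 * N)) : gamma i * gamma i = 1 := by
  ext s t
  rw [gamma_mul_apply]
  have h : ∀ b : Fin N, gammaFactor i b * gammaFactor i b = 1 := by
    intro b
    have h1 : pauli1 * pauli1 = 1 := by ext x y; fin_cases x <;> fin_cases y <;> simp [pauli1]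
    have h2 : pauli2 * pauli2 = 1 := by ext x y; fin_cases x <;> fin_cases y <;> simp [pauli2]
    have h3 : pauli3 * pauli3 = 1 := by ext x y; fin_cases x <;> fin_cases y <;> simp [pauli3]
    unfold gammaFactor
    split_ifs <;> simp [h1, h2, h3]
  simp only [h, Matrix.one_apply]
  by_cases hst : s = t
  · simp [hst]
  · obtain ⟨b, hb⟩ := Function.ne_iff.mp hst
    rw [if_neg hst]
    exact Finset.prod_eq_zero (Finset.mem_univ b) (by simp [hb])

theorem gamma_anticomm {N : ℕ} (i j : Fin (2 * N)) (hij : i ≠ j) :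
    gamma i * gamma j = -(gamma j * gamma i) := by
  have h13 : pauli1 * pauli3 = -(pauli3 * pauli1) := by
    ext x y; fin_cases x <;> fin_cases y <;> simp [pauli1, pauli3]
  have h23 : pauli2 * pauli3 = -(pauli3 * pauli2) := by
    ext x y; fin_cases x <;> fin_cases y <;> simp [pauli2, pauli3]
  have h12 : pauli1 * pauli2 = -(pauli2 * pauli1) := by
    ext x y; fin_cases x <;> fin_cases y <;> simp [pauli1, pauli2]
  have hv : i.val ≠ j.val := fun h => hij (Fin.ext h)
  have hlt : min (i.val / 2) (j.val / 2) < N := by omega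
  have key : ∀ b : Fin N, gammaFactor i b * gammaFactor j b =
      (if b = ⟨min (i.val / 2) (j.val / 2), hlt⟩ then (-1 : ℂ) else 1) •
        (gammaFactor j b * gammaFactor i b) := by
    intro b
    simp only [Fin.ext_iff]
    unfold gammaFactor
    split_ifs <;> first | omega | simp [h13, h23, h12]
  ext s t
  rw [Matrix.neg_apply, gamma_mul_apply, gamma_mul_apply]
  simp only [key, Matrix.smul_apply, smul_eq_mul, Finset.prod_mul_distrib]
  simp

/-- The Euclidean quadratic form `∑ (v^i)²` on `ℂ^{2N}`. -/
def euclid (N : ℕ) : QuadraticForm ℂ (Vec N) :=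
  QuadraticMap.weightedSumSquares ℂ (fun _ => (1 : ℂ))

theorem gammaVec_sq (N : ℕ) (v : Vec N) :
    gammaVec N v * gammaVec N v = algebraMap ℂ (SpinMat N) (euclid N v) := by
  have h1 : gammaVec N v * gammaVec N v =
      ∑ i, ∑ j, (v i * v j) • (gamma i * gamma j) := by
    simp only [gammaVec, Fintype.linearCombination_apply, Finset.sum_mul, Finset.mul_sum,
      smul_mul_smul_comm]
    rw [Finset.sum_comm]
  have h2 : gammaVec N v * gammaVec N v =
      ∑ i, ∑ j, (v i * v j) • (gamma j * gamma i) := by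
    rw [h1, Finset.sum_comm]
    simp only [mul_comm]
  have h3 : ∀ i j : Fin (2 * N), gamma i * gamma j + gamma j * gamma i =
      if i = j then (2 : ℂ) • (1 : SpinMat N) else 0 := by
    intro i j
    split_ifs with h
    · rw [h, gamma_sq, two_smul]
    · rw [gamma_anticomm i j h]; simp
  have h4 : (2 : ℂ) • (gammaVec N v * gammaVec N v) =
      (2 : ℂ) • algebraMap ℂ (SpinMat N) (euclid N v) := by
    rw [two_smul]
    nth_rewrite 1 [h1]
    rw [h2]
    simp only [← Finset.sum_add_distrib, ← smul_add, h3]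
    simp [euclid, QuadraticMap.weightedSumSquares_apply, Algebra.algebraMap_eq_smul_one,
      Finset.smul_sum, smul_smul, mul_comm]
  exact smul_right_injective _ (two_ne_zero : (2 : ℂ) ≠ 0) h4

/-- The spinor representation of the Clifford algebra. -/
def spinRep (N : ℕ) : CliffordAlgebra (euclid N) →ₐ[ℂ] SpinMat N :=
  CliffordAlgebra.lift (euclid N) ⟨gammaVec N, gammaVec_sq N⟩

/-! ## Polyforms and the Clifford map -/

/-- Polyforms with constant complex coefficients; the product is the wedge product. -/
abbrev Polyform (N : ℕ) : Type := ExteriorAlgebra ℂ (Vec N)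

/-- The one-form `dx^i`. -/
def dx {N : ℕ} (i : Fin (2 * N)) : Polyform N := ExteriorAlgebra.ι ℂ (Pi.single i 1)

/-- The Clifford map `dx^{i₁} ∧ ⋯ ∧ dx^{i_k} ↦ γ^{i₁ … i_k}` (antisymmetrised product; see
`cliffordMap_prod`) from polyforms to bispinors. -/
def cliffordMap (N : ℕ) : Polyform N →ₗ[ℂ] SpinMat N :=
  (spinRep N).toLinearMap ∘ₗ (CliffordAlgebra.equivExterior (euclid N)).symm.toLinearMap

theorem contract_prod {N : ℕ} (f : Module.Dual ℂ (Vec N)) (l : List (Fin (2 * N)))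
    (h : ∀ j ∈ l, f (Pi.single j 1) = 0) :
    CliffordAlgebra.contractLeft (Q := (0 : QuadraticForm ℂ (Vec N))) f
      ((l.map dx).prod : Polyform N) = 0 := by
  induction l with
  | nil => simp
  | cons j l ih =>
    rw [List.map_cons, List.prod_cons]
    erw [CliffordAlgebra.contractLeft_ι_mul]
    rw [h j (by simp)]
    erw [ih (fun j hj => h j (by simp [hj]))]
    simp

theorem cliffordMap_prod {N : ℕ} (l : List (Fin (2 * N))) (hl : l.Nodup) :
    cliffordMap N ((l.map dx).prod) = (l.map gamma).prod := by
  have key : CliffordAlgebra.equivExterior (euclid N)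
      ((l.map fun i => CliffordAlgebra.ι (euclid N) (Pi.single i 1)).prod) =
      (l.map dx).prod := by
    induction l with
    | nil => simp [CliffordAlgebra.equivExterior]
    | cons j l ih =>
      have hj := List.nodup_cons.mp hl
      have ih' := ih hj.2
      rw [List.map_cons, List.prod_cons, List.map_cons, List.prod_cons]
      change CliffordAlgebra.changeForm CliffordAlgebra.changeForm.associated_neg_proof _ = _
      rw [CliffordAlgebra.changeForm_ι_mul]
      change CliffordAlgebra.changeForm CliffordAlgebra.changeForm.associated_neg_proof _ = _ at ih'
      rw [ih', contract_prod]
      · simp only [sub_zero]; rfl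
      · intro m hm
        have hjm : m ≠ j := fun h => hj.1 (h ▸ hm)
        simp [euclid, QuadraticMap.associated_apply, QuadraticMap.weightedSumSquares_apply,
          Pi.single_apply, hjm, hjm.symm, mul_add, Finset.sum_add_distrib]
  have h : cliffordMap N (CliffordAlgebra.equivExterior (euclid N)
      ((l.map fun i => CliffordAlgebra.ι (euclid N) (Pi.single i 1)).prod)) =
      spinRep N ((l.map fun i => CliffordAlgebra.ι (euclid N) (Pi.single i 1)).prod) :=
    congrArg (spinRep N) ((CliffordAlgebra.equivExterior (euclid N)).symm_apply_apply _)
  rw [← key, h, map_list_prod, List.map_map]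
  congr 2
  funext i
  simp [spinRep, gammaVec, Fintype.linearCombination_apply_single]

/-- The `p`-form part of a polyform. -/
def formPart {N : ℕ} (p : ℕ) (ω : Polyform N) : Polyform N :=
  GradedRing.proj (fun n : ℕ => ⋀[ℂ]^n (Vec N)) p ω

/-- The type of a polyform: the lowest form rank appearing in it (`⊤` for the zero polyform). -/
def formType {N : ℕ} (ω : Polyform N) : ℕ∞ :=
  ⨅ (p : ℕ) (_ : formPart p ω ≠ 0), (p : ℕ∞)

/-- The two-form `½ M_ij dx^i ∧ dx^j` of a matrix `M`. -/
def twoForm {N : ℕ} (M : Matrix (Fin (2 * N)) (Fin (2 * N)) ℂ) : Polyform N :=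
  (1 / 2 : ℂ) • ∑ i, ∑ j, M i j • (dx i * dx j)

/-- The volume form `dx^1 ∧ ⋯ ∧ dx^{2N}`. -/
def volForm (N : ℕ) : Polyform N := ((List.finRange (2 * N)).map dx).prod

/-- The contraction operators, `v₁ ∧ ⋯ ∧ v_q ↦ ι_{v₁} ∘ ⋯ ∘ ι_{v_q}`, where vectors act on forms
through the Euclidean metric. -/
def contraction (N : ℕ) : Polyform N →ₐ[ℂ] Module.End ℂ (Polyform N) :=
  ExteriorAlgebra.lift ℂ
    ⟨(CliffordAlgebra.contractLeft (Q := (0 : QuadraticForm ℂ (Vec N)))) ∘ₗ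
        (Pi.basisFun ℂ (Fin (2 * N))).toDual,
      fun _ => LinearMap.ext fun ω => CliffordAlgebra.contractLeft_contractLeft _ ω⟩

/-- The complex-linear Hodge star, `*(v₁ ∧ ⋯ ∧ v_q) = ι_{v_q} ⋯ ι_{v₁} vol`, so that
`dx^I ∧ *dx^I = vol` for every multi-index `I`. -/
def hodgeStar {N : ℕ} (ω : Polyform N) : Polyform N :=
  contraction N (CliffordAlgebra.reverse (Q := (0 : QuadraticForm ℂ (Vec N))) ω) (volForm N)

/-! ## Spinor pairings, chirality, purity, bispinors -/

/-- `B` is an intertwiner between the gamma matrices and their transposes, up to a sign: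
`B γ_i = ± γ_iᵗ B`. -/
def IsIntertwiner {N : ℕ} (B : SpinMat N) : Prop :=
  IsUnit B ∧ ∃ ε : ℂ, (ε = 1 ∨ ε = -1) ∧ ∀ i, B * gamma i = ε • ((gamma i)ᵀ * B)

/-- The inner product `η₁ · η₂ = η₁ᶜ η₂`, with `ηᶜ = ηᵗ B`. -/
def spinorInner {N : ℕ} (B : SpinMat N) (η₁ η₂ : Spinor N) : ℂ := (η₁ ᵥ* B) ⬝ᵥ η₂

/-- The bispinor `η₁ ⊗ η₂ᶜ : ψ ↦ η₁ (η₂ · ψ)`. -/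
def bispinor {N : ℕ} (B : SpinMat N) (η₁ η₂ : Spinor N) : SpinMat N :=
  Matrix.vecMulVec η₁ (η₂ ᵥ* B)

/-- The chirality matrix `c γ_1 ⋯ γ_{2N}`; it squares to one when `c² = (-1)^N`. -/
def chiralityMat (N : ℕ) (c : ℂ) : SpinMat N :=
  c • ((List.finRange (2 * N)).map gamma).prod

/-- The annihilator `{v ∈ ℂ^{2N} | v^i γ_i η = 0}` of a spinor. -/
def annihilator {N : ℕ} (η : Spinor N) : Submodule ℂ (Vec N) :=
  LinearMap.ker (LinearMap.applyₗ η ∘ₗ Matrix.toLin'.toLinearMap ∘ₗ gammaVec N)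

/-- A spinor is pure if its annihilator has dimension `N`. (For `N > 0` it is then nonzero.) -/
def IsPure {N : ℕ} (η : Spinor N) : Prop := Module.finrank ℂ (annihilator η) = N

/-- The `q`-form of bilinears
`η₁ · γ_(q) η₂ = (1 / q!) (η₁ · γ_{i₁ … i_q} η₂) dx^{i₁} ∧ ⋯ ∧ dx^{i_q}`. The wedge product
antisymmetrises the product of gamma matrices. -/
def spinorBilinear {N : ℕ} (B : SpinMat N) (q : ℕ) (η₁ η₂ : Spinor N) : Polyform N :=
  ((q.factorial : ℂ)⁻¹) • ∑ f : Fin q → Fin (2 * N),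
    spinorInner B η₁ ((List.ofFn fun a => gamma (f a)).prod *ᵥ η₂) •
      (List.ofFn fun a => dx (f a)).prod

end

/-! ## Wedge products, contractions and form degrees -/

/-! Under the Clifford map, left and right multiplication by a vector `v` become `v ∧ · + ι_v` and,
up to the grade involution, `v ∧ · - ι_v`. Everything about `Φ` follows from three properties of the
bispinor. Vectors annihilating `I` or `I'` give first-order equations for `Φ`. The two chiralities
make `Φ` even and an eigenvector, with eigenvalue `c⁻¹`, of contraction into the volume form.
Finally `Φ ≠ 0`.

If `S ≠ 0`, the degree-one part of the equations says that `M` is `S` on the annihilator of `I` and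
`-S` on that of `I'`. These eigenspaces meet in zero and have dimension `N` each, so they span.
Hence `S ι_v Φ = -(M v) ∧ Φ` for every `v`. This recursion in the degree has the exponential as its
only solution with the given zero-form (`formPart_two_mul_of_contr`), because a form of positive
degree is determined by its contractions.

If `S = 0`, the hypothesis leaves degree `2k+2` as the only one up to `2k+3` where `Φ` may be
nonzero. Duality determines `Φ` from its degrees at most `N ≤ 2k+3`, so `Φ ≠ 0` forces `∧^{k+1} M ≠
0` and `N ≥ 2k+2`. The equations then put both annihilators inside the kernel of `M`. By maximal
isotropy they contain its image, and `∧^{k+2} M = 0` follows (`polarizes_of_eq_zero`).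

In both cases `Polarizes` holds, which gives `M² = S²` and the linear equations on the spinors. The
Hodge relations are the duality of `Φ` read degree by degree, and the bilinears are the components
of `Φ` extracted by traces (`sum_trace_smul_dx`). -/

namespace Polyform

open ExteriorAlgebra

variable {N : ℕ}

/-- Contraction of a form with a vector, through the Euclidean metric. -/
noncomputable def contr : Vec N →ₗ[ℂ] Polyform N →ₗ[ℂ] Polyform N :=
  (CliffordAlgebra.contractLeft (Q := (0 : QuadraticForm ℂ (Vec N)))) ∘ₗ
    (Pi.basisFun ℂ (Fin (2 * N))).toDual

/-- The grade involution `ω ↦ (-1)^p ω` on `p`-forms. -/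
def gradeInv : Polyform N →ₐ[ℂ] Polyform N :=
  CliffordAlgebra.involute (Q := (0 : QuadraticForm ℂ (Vec N)))

/-- The reversal `v₁ ∧ ⋯ ∧ v_p ↦ v_p ∧ ⋯ ∧ v₁`. -/
def rev : Polyform N →ₗ[ℂ] Polyform N :=
  CliffordAlgebra.reverse (Q := (0 : QuadraticForm ℂ (Vec N)))

theorem induction_on {P : Polyform N → Prop} (ω : Polyform N)
    (scalar : ∀ r : ℂ, P (algebraMap ℂ _ r)) (add : ∀ x y, P x → P y → P (x + y))
    (ι_mul : ∀ (v : Vec N) (x : Polyform N), P x → P (ι ℂ v * x)) : P ω :=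
  CliffordAlgebra.left_induction (0 : QuadraticForm ℂ (Vec N)) scalar add
    (fun x v hx => ι_mul v x hx) ω

theorem toDual_apply (v u : Vec N) : (Pi.basisFun ℂ (Fin (2 * N))).toDual v u = v ⬝ᵥ u := by
  conv_lhs => rw [← (Pi.basisFun ℂ (Fin (2 * N))).sum_repr u, map_sum]
  simp only [map_smul, Module.Basis.toDual_apply_left]
  simp [dotProduct, mul_comm]

theorem contr_ι_mul (v u : Vec N) (ω : Polyform N) :
    contr v (ι ℂ u * ω) = (v ⬝ᵥ u) • ω - ι ℂ u * contr v ω := by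
  rw [← toDual_apply]
  exact CliffordAlgebra.contractLeft_ι_mul (Q := (0 : QuadraticForm ℂ (Vec N))) _ u ω

theorem contr_algebraMap (v : Vec N) (r : ℂ) : contr v (algebraMap ℂ (Polyform N) r) = 0 :=
  CliffordAlgebra.contractLeft_algebraMap (Q := (0 : QuadraticForm ℂ (Vec N))) _ r

theorem contr_ι (v u : Vec N) : contr v (ι ℂ u) = algebraMap ℂ (Polyform N) (v ⬝ᵥ u) := by
  rw [← toDual_apply]
  exact CliffordAlgebra.contractLeft_ι (Q := (0 : QuadraticForm ℂ (Vec N))) _ u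

theorem contr_comm (v u : Vec N) (ω : Polyform N) :
    contr v (contr u ω) = -contr u (contr v ω) :=
  CliffordAlgebra.contractLeft_comm (Q := (0 : QuadraticForm ℂ (Vec N))) _ _ ω

theorem ι_mul_ι_mul (v u : Vec N) (ω : Polyform N) :
    ι ℂ v * (ι ℂ u * ω) = -(ι ℂ u * (ι ℂ v * ω)) := by
  have h := ι_add_mul_swap (R := ℂ) v u
  rw [← mul_assoc, ← mul_assoc, ← neg_mul, eq_neg_of_add_eq_zero_left h]

theorem gradeInv_ι_mul (v : Vec N) (ω : Polyform N) :
    gradeInv (ι ℂ v * ω) = -(ι ℂ v * gradeInv ω) := by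
  rw [map_mul, ← neg_mul]
  congr 1
  exact CliffordAlgebra.involute_ι (Q := (0 : QuadraticForm ℂ (Vec N))) v

theorem gradeInv_contr (v : Vec N) (ω : Polyform N) :
    gradeInv (contr v ω) = -contr v (gradeInv ω) := by
  induction ω using induction_on with
  | scalar r => simp [contr_algebraMap]
  | add x y hx hy => simp only [map_add, hx, hy, neg_add]
  | ι_mul u x hx =>
    rw [gradeInv_ι_mul, contr_ι_mul, map_sub, map_smul, gradeInv_ι_mul, hx, map_neg, contr_ι_mul]
    simp

theorem mul_ι (v : Vec N) (ω : Polyform N) : ω * ι ℂ v = ι ℂ v * gradeInv ω := by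
  induction ω using induction_on with
  | scalar r => simp [Algebra.commutes]
  | add x y hx hy => simp only [map_add, hx, hy, add_mul, mul_add]
  | ι_mul u x hx => rw [gradeInv_ι_mul, mul_assoc, hx, mul_neg, ι_mul_ι_mul]

theorem rev_algebraMap (r : ℂ) : rev (algebraMap ℂ (Polyform N) r) = algebraMap ℂ _ r :=
  CliffordAlgebra.reverse.commutes (Q := (0 : QuadraticForm ℂ (Vec N))) r

theorem rev_mul (x y : Polyform N) : rev (x * y) = rev y * rev x :=
  CliffordAlgebra.reverse.map_mul (Q := (0 : QuadraticForm ℂ (Vec N))) x y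

theorem rev_ι (v : Vec N) : rev (ι ℂ v) = ι ℂ v :=
  CliffordAlgebra.reverse_ι (Q := (0 : QuadraticForm ℂ (Vec N))) v

theorem rev_ι_mul (v : Vec N) (ω : Polyform N) :
    rev (ι ℂ v * ω) = ι ℂ v * gradeInv (rev ω) := by
  rw [rev_mul, rev_ι, mul_ι]

theorem sum_smul_dx (v : Vec N) : ∑ i, v i • dx i = ι ℂ v := by
  simp only [dx, ← map_smul, ← map_sum]
  congr 1
  ext j
  simp [Finset.sum_apply, Pi.single_apply]

/-! ### Homogeneous parts -/

theorem formPart_add (p : ℕ) (x y : Polyform N) :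
    formPart p (x + y) = formPart p x + formPart p y := map_add _ _ _

theorem formPart_smul (p : ℕ) (a : ℂ) (x : Polyform N) :
    formPart p (a • x) = a • formPart p x :=
  map_smul (GradedAlgebra.proj (fun n : ℕ => ⋀[ℂ]^n (Vec N)) p) a x

theorem formPart_sum {α : Type*} (s : Finset α) (p : ℕ) (x : α → Polyform N) :
    formPart p (∑ a ∈ s, x a) = ∑ a ∈ s, formPart p (x a) := map_sum _ _ _

theorem formPart_mem (p : ℕ) (x : Polyform N) : formPart p x ∈ ⋀[ℂ]^p (Vec N) :=
  SetLike.coe_mem (DirectSum.decompose (fun n : ℕ => ⋀[ℂ]^n (Vec N)) x p)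

theorem formPart_of_mem {p : ℕ} {x : Polyform N} (hx : x ∈ ⋀[ℂ]^p (Vec N)) (q : ℕ) :
    formPart q x = if q = p then x else 0 := by
  split_ifs with h
  · subst h
    exact DirectSum.decompose_of_mem_same (fun n : ℕ => ⋀[ℂ]^n (Vec N)) hx
  · exact DirectSum.decompose_of_mem_ne (fun n : ℕ => ⋀[ℂ]^n (Vec N)) hx (Ne.symm h)

theorem ext_formPart {x y : Polyform N} (h : ∀ p, formPart p x = formPart p y) : x = y := by
  apply (DirectSum.decompose (fun n : ℕ => ⋀[ℂ]^n (Vec N))).injective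
  ext p
  exact h p

theorem ι_mem (v : Vec N) : ι ℂ v ∈ ⋀[ℂ]^1 (Vec N) := by
  simpa only [pow_one] using LinearMap.mem_range_self _ v

theorem algebraMap_mem (r : ℂ) : algebraMap ℂ (Polyform N) r ∈ ⋀[ℂ]^0 (Vec N) := by
  change _ ∈ LinearMap.range (ι ℂ : Vec N →ₗ[ℂ] Polyform N) ^ 0
  rw [pow_zero]
  exact Submodule.algebraMap_mem r

theorem ι_mul_mem {p : ℕ} (v : Vec N) {x : Polyform N} (hx : x ∈ ⋀[ℂ]^p (Vec N)) :
    ι ℂ v * x ∈ ⋀[ℂ]^(p + 1) (Vec N) := by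
  rw [add_comm]
  exact SetLike.mul_mem_graded (A := fun n : ℕ => ⋀[ℂ]^n (Vec N)) (ι_mem v) hx

theorem formPart_algebraMap (p : ℕ) (r : ℂ) :
    formPart p (algebraMap ℂ (Polyform N) r) = if p = 0 then algebraMap ℂ _ r else 0 :=
  formPart_of_mem (algebraMap_mem r) p

theorem sum_formPart (x : Polyform N) :
    ∃ n, ∑ p ∈ Finset.range n, formPart p x = x := by
  classical
  obtain ⟨n, hn⟩ := Finset.exists_nat_subset_range
    (DirectSum.decompose (fun n : ℕ => ⋀[ℂ]^n (Vec N)) x).support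
  refine ⟨n, ?_⟩
  conv_rhs => rw [← DirectSum.sum_support_decompose (fun n : ℕ => ⋀[ℂ]^n (Vec N)) x]
  refine (Finset.sum_subset hn fun p _ hp => ?_).symm
  rw [DFinsupp.notMem_support_iff] at hp
  exact congrArg Subtype.val hp

theorem formPart_zero_ι_mul (v : Vec N) (x : Polyform N) : formPart 0 (ι ℂ v * x) = 0 := by
  obtain ⟨n, hn⟩ := sum_formPart x
  rw [← hn, Finset.mul_sum, formPart_sum]
  exact Finset.sum_eq_zero fun p _ => by
    rw [formPart_of_mem (ι_mul_mem v (formPart_mem p x)), if_neg (by omega)]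

theorem formPart_succ_ι_mul (p : ℕ) (v : Vec N) (x : Polyform N) :
    formPart (p + 1) (ι ℂ v * x) = ι ℂ v * formPart p x := by
  obtain ⟨n, hn⟩ := sum_formPart x
  have h : ∀ q, formPart (p + 1) (ι ℂ v * formPart q x) =
      ι ℂ v * formPart p (formPart q x) := fun q => by
    rw [formPart_of_mem (ι_mul_mem v (formPart_mem q x)), formPart_of_mem (formPart_mem q x)]
    simp only [add_left_inj, mul_ite, mul_zero]
  rw [← hn, Finset.mul_sum, formPart_sum, formPart_sum, Finset.mul_sum]
  exact Finset.sum_congr rfl fun q _ => h q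

theorem contr_formPart_zero (v : Vec N) (x : Polyform N) : contr v (formPart 0 x) = 0 := by
  induction x using induction_on with
  | scalar r => simp [formPart_algebraMap, contr_algebraMap]
  | add x y hx hy => rw [formPart_add, map_add, hx, hy, add_zero]
  | ι_mul u x hx => rw [formPart_zero_ι_mul, map_zero]

theorem formPart_contr (p : ℕ) (v : Vec N) (x : Polyform N) :
    formPart p (contr v x) = contr v (formPart (p + 1) x) := by
  induction x using induction_on generalizing p with
  | scalar r =>
    rw [contr_algebraMap, formPart_algebraMap, if_neg p.succ_ne_zero, map_zero]
    exact map_zero _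
  | add x y hx hy => simp only [formPart_add, map_add, hx, hy]
  | ι_mul u x hx =>
    rw [formPart_succ_ι_mul, contr_ι_mul, contr_ι_mul, sub_eq_add_neg, formPart_add,
      formPart_smul, ← neg_one_smul ℂ, formPart_smul, neg_one_smul, sub_eq_add_neg]
    cases p with
    | zero => rw [formPart_zero_ι_mul, contr_formPart_zero, mul_zero]
    | succ p => rw [formPart_succ_ι_mul, hx]

theorem gradeInv_formPart (p : ℕ) (x : Polyform N) :
    gradeInv (formPart p x) = (-1 : ℂ) ^ p • formPart p x := by
  induction x using induction_on generalizing p with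
  | scalar r => rw [formPart_algebraMap]; split_ifs with h <;> simp [h]
  | add x y hx hy => simp only [formPart_add, map_add, hx, hy, smul_add]
  | ι_mul u x hx =>
    cases p with
    | zero => simp [formPart_zero_ι_mul]
    | succ p => rw [formPart_succ_ι_mul, gradeInv_ι_mul, hx, mul_smul_comm, pow_succ]; simp

theorem formPart_gradeInv (p : ℕ) (x : Polyform N) :
    formPart p (gradeInv x) = (-1 : ℂ) ^ p • formPart p x := by
  induction x using induction_on generalizing p with
  | scalar r => rw [AlgHom.commutes, formPart_algebraMap]; split_ifs with h <;> simp [h]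
  | add x y hx hy => simp only [formPart_add, map_add, hx, hy, smul_add]
  | ι_mul u x hx =>
    rw [gradeInv_ι_mul, ← neg_one_smul ℂ, formPart_smul]
    cases p with
    | zero => simp [formPart_zero_ι_mul]
    | succ p => rw [formPart_succ_ι_mul, formPart_succ_ι_mul, hx, mul_smul_comm, pow_succ]; simp

theorem rev_formPart (p : ℕ) (x : Polyform N) :
    rev (formPart p x) = (-1 : ℂ) ^ p.choose 2 • formPart p x := by
  induction x using induction_on generalizing p with
  | scalar r =>
    rw [formPart_algebraMap]
    split_ifs with h
    · simp [h, rev_algebraMap]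
    · simp
  | add x y hx hy => simp only [formPart_add, map_add, hx, hy, smul_add]
  | ι_mul u x hx =>
    cases p with
    | zero => simp [formPart_zero_ι_mul]
    | succ p =>
      rw [formPart_succ_ι_mul, rev_ι_mul, hx, map_smul, gradeInv_formPart, mul_smul_comm,
        mul_smul_comm, smul_smul, ← pow_add, Nat.choose_succ_succ' p 1, Nat.choose_one_right,
        add_comm]

/-- Euler's identity: `∑ dx^i ∧ ι_i` is the number operator. In positive degree it recovers a form
from its contractions. -/
theorem sum_dx_mul_contr (p : ℕ) (x : Polyform N) :
    ∑ i, dx i * contr (Pi.single i 1) (formPart p x) = (p : ℂ) • formPart p x := by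
  induction x using induction_on generalizing p with
  | scalar r =>
    rw [formPart_algebraMap]
    split_ifs with h <;> simp [h, contr_algebraMap]
  | add x y hx hy =>
    simp only [formPart_add, map_add, mul_add, Finset.sum_add_distrib, hx, hy, smul_add]
  | ι_mul u x hx =>
    cases p with
    | zero => simp [formPart_zero_ι_mul]
    | succ p =>
      rw [formPart_succ_ι_mul]
      simp only [contr_ι_mul, mul_sub, Finset.sum_sub_distrib, single_dotProduct, one_mul]
      have h : ∀ i, dx i * (ι ℂ u * contr (Pi.single i 1) (formPart p x)) =
          -(ι ℂ u * (dx i * contr (Pi.single i 1) (formPart p x))) := fun i => ι_mul_ι_mul _ _ _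
      simp only [h, Finset.sum_neg_distrib, ← Finset.mul_sum, hx, mul_smul_comm]
      simp only [← smul_mul_assoc, ← Finset.sum_mul, sum_smul_dx]
      rw [Nat.cast_succ, add_smul, one_smul, add_mul, sub_neg_eq_add, add_comm]

theorem formPart_eq_of_contr {p : ℕ} (hp : p ≠ 0) {x y : Polyform N}
    (h : ∀ v, contr v (formPart p x) = contr v (formPart p y)) :
    formPart p x = formPart p y := by
  have h' : (p : ℂ) • formPart p x = (p : ℂ) • formPart p y := by
    rw [← sum_dx_mul_contr, ← sum_dx_mul_contr]
    simp only [h]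
  exact smul_right_injective _ (Nat.cast_ne_zero.mpr hp : (p : ℂ) ≠ 0) h'

theorem formPart_zero_eq (x : Polyform N) :
    formPart 0 x = algebraMap ℂ _ (algebraMapInv x) := by
  induction x using induction_on with
  | scalar r => simp [formPart_algebraMap]
  | add x y hx hy => rw [formPart_add, hx, hy, map_add, map_add]
  | ι_mul u x hx => simp [formPart_zero_ι_mul, algebraMapInv]

/-- Successive contraction with the basis vectors in a list, the head first. -/
noncomputable def contrList : List (Fin (2 * N)) → Polyform N →ₗ[ℂ] Polyform N
  | [] => LinearMap.id
  | i :: l => contrList l ∘ₗ contr (Pi.single i 1)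

/-- The components of a form are its iterated contractions with basis vectors. -/
theorem sum_iterated_contr (p : ℕ) (x : Polyform N) :
    ∑ f : Fin p → Fin (2 * N),
      algebraMapInv (contrList (List.ofFn f) x) •
        (List.ofFn fun a => dx (f a)).prod = (p.factorial : ℂ) • formPart p x := by
  induction p generalizing x with
  | zero => simp [formPart_zero_eq, contrList, Algebra.algebraMap_eq_smul_one]
  | succ p ih =>
    rw [Fin.consEquiv (fun _ => Fin (2 * N)) |>.sum_comp _ |>.symm, Fintype.sum_prod_type]
    simp only [Fin.consEquiv_apply, List.ofFn_succ, Fin.cons_zero, Fin.cons_succ, contrList,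
      LinearMap.comp_apply,       List.prod_cons, ← mul_smul_comm, ← Finset.mul_sum, ih, formPart_contr]
    simp only [mul_smul_comm]
    rw [← Finset.smul_sum, sum_dx_mul_contr, smul_smul, Nat.factorial_succ, Nat.cast_mul,
      mul_comm (p.factorial : ℂ)]

theorem prod_dx_eq_zero {l : List (Fin (2 * N))} (h : ¬ l.Nodup) :
    ((l.map dx).prod : Polyform N) = 0 := by
  induction l with
  | nil => simp at h
  | cons j l ih =>
    rw [List.nodup_cons, not_and_or, not_not] at h
    rw [List.map_cons, List.prod_cons]
    rcases h with h | h
    · clear ih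
      induction l with
      | nil => simp at h
      | cons i l ih =>
        rw [List.map_cons, List.prod_cons]
        rcases List.mem_cons.mp h with rfl | h
        · rw [← mul_assoc]
          simp [dx]
        · have := ι_mul_ι_mul (Pi.single j 1) (Pi.single i 1) (l.map dx).prod
          unfold dx at *
          rw [this, ih h, mul_zero, neg_zero]
    · rw [ih h, mul_zero]

/-- Expanded in components, every monomial of such a degree repeats an index, by the pigeonhole
principle. -/
theorem formPart_eq_zero_of_lt {p : ℕ} (hp : 2 * N < p) (x : Polyform N) : formPart p x = 0 := by
  have h := sum_iterated_contr p x
  rw [Finset.sum_eq_zero] at h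
  · exact (smul_eq_zero.mp h.symm).resolve_left (Nat.cast_ne_zero.mpr p.factorial_ne_zero)
  · intro f _
    have := prod_dx_eq_zero (l := List.ofFn f) fun h => by
      have := Fintype.card_le_of_injective f (List.nodup_ofFn.mp h)
      simp only [Fintype.card_fin] at this
      omega
    rw [List.map_ofFn] at this
    exact smul_eq_zero_of_right _ this

end Polyform

/-! ## The Clifford map -/

namespace Polyform

open ExteriorAlgebra

variable {N : ℕ}

/-- Passing from the Euclidean form to the zero form changes the quadratic form by `-euclid N`. This
sign turns the subtracted contraction in `changeForm_ι_mul` into an added one. -/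
theorem associated_euclid (v : Vec N) :
    QuadraticMap.associated (R := ℂ) (-euclid N) v =
      -(Pi.basisFun ℂ (Fin (2 * N))).toDual v := by
  ext i
  simp [euclid, QuadraticMap.associated_apply, QuadraticMap.weightedSumSquares_apply,
    Pi.single_apply, mul_add, add_mul, Finset.sum_add_distrib]
  rw [toDual_apply, dotProduct_single_one]
  ring

theorem equivExterior_ι_mul (v : Vec N) (x : CliffordAlgebra (euclid N)) :
    CliffordAlgebra.equivExterior (euclid N) (CliffordAlgebra.ι (euclid N) v * x) =
      ι ℂ v * CliffordAlgebra.equivExterior (euclid N) x +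
        contr v (CliffordAlgebra.equivExterior (euclid N) x) := by
  have h : ∀ y : Polyform N, CliffordAlgebra.contractLeft (Q := (0 : QuadraticForm ℂ (Vec N)))
      (QuadraticMap.associated (R := ℂ) (-euclid N) v) y = -contr v y := fun y => by
    rw [associated_euclid, map_neg]
    rfl
  exact (CliffordAlgebra.changeForm_ι_mul CliffordAlgebra.changeForm.associated_neg_proof
    v x).trans ((congrArg _ (h _)).trans (sub_neg_eq_add _ _))

theorem equivExterior_algebraMap (r : ℂ) :
    CliffordAlgebra.equivExterior (euclid N) (algebraMap ℂ _ r) = algebraMap ℂ _ r :=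
  CliffordAlgebra.changeForm_algebraMap CliffordAlgebra.changeForm.associated_neg_proof r

/-- Induction along Clifford multiplication `v ∧ · + ι_v` by vectors. -/
theorem clifford_induction_on {P : Polyform N → Prop} (ω : Polyform N)
    (scalar : ∀ r : ℂ, P (algebraMap ℂ _ r)) (add : ∀ x y, P x → P y → P (x + y))
    (vec_mul : ∀ (v : Vec N) (x : Polyform N), P x → P (ι ℂ v * x + contr v x)) : P ω := by
  obtain ⟨x, rfl⟩ := (CliffordAlgebra.equivExterior (euclid N)).surjective ω
  induction x using CliffordAlgebra.left_induction with
  | algebraMap r => rw [equivExterior_algebraMap]; exact scalar r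
  | add x y hx hy => rw [map_add]; exact add _ _ hx hy
  | ι_mul x v hx => rw [equivExterior_ι_mul]; exact vec_mul _ _ hx

theorem cliffordMap_equivExterior (x : CliffordAlgebra (euclid N)) :
    cliffordMap N (CliffordAlgebra.equivExterior (euclid N) x) = spinRep N x :=
  congrArg (spinRep N) ((CliffordAlgebra.equivExterior (euclid N)).symm_apply_apply x)

theorem cliffordMap_algebraMap (r : ℂ) :
    cliffordMap N (algebraMap ℂ _ r) = algebraMap ℂ _ r := by
  rw [← equivExterior_algebraMap, cliffordMap_equivExterior, AlgHom.commutes]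

theorem gammaVec_mul_cliffordMap (v : Vec N) (ω : Polyform N) :
    gammaVec N v * cliffordMap N ω = cliffordMap N (ι ℂ v * ω + contr v ω) := by
  obtain ⟨x, rfl⟩ := (CliffordAlgebra.equivExterior (euclid N)).surjective ω
  rw [← equivExterior_ι_mul, cliffordMap_equivExterior, cliffordMap_equivExterior, map_mul]
  congr 1
  simp [spinRep]

theorem cliffordMap_ι (v : Vec N) : cliffordMap N (ι ℂ v) = gammaVec N v := by
  have h := gammaVec_mul_cliffordMap v (algebraMap ℂ (Polyform N) 1)
  rw [cliffordMap_algebraMap, contr_algebraMap] at h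
  simpa using h.symm

theorem gammaVec_single (i : Fin (2 * N)) : gammaVec N (Pi.single i 1) = gamma i := by
  simp [gammaVec, Fintype.linearCombination_apply_single]

/-- Left and right multiplications commute, so induction along left Clifford multiplication reduces
the claim to commuting `u ∧ · + ι_u` past the right-hand operator; the two scalar terms `u ⬝ᵥ v`
cancel. -/
theorem cliffordMap_mul_gammaVec (v : Vec N) (ω : Polyform N) :
    cliffordMap N ω * gammaVec N v =
      cliffordMap N (ι ℂ v * gradeInv ω - contr v (gradeInv ω)) := by
  induction ω using clifford_induction_on with
  | scalar r =>
    rw [cliffordMap_algebraMap, AlgHom.commutes, contr_algebraMap, sub_zero]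
    simp only [Algebra.algebraMap_eq_smul_one, smul_mul_assoc, mul_smul_comm, one_mul, mul_one,
      map_smul, cliffordMap_ι]
  | add x y hx hy => simp only [map_add, add_mul, hx, hy, mul_add]; rw [← map_add]; congr 1; abel
  | vec_mul u x hx =>
    rw [← gammaVec_mul_cliffordMap, mul_assoc, hx, gammaVec_mul_cliffordMap]
    congr 1
    simp only [map_add, map_sub, gradeInv_ι_mul, gradeInv_contr, mul_add, mul_sub, map_neg,
      contr_ι_mul, mul_neg]
    rw [ι_mul_ι_mul u v, contr_comm u v, dotProduct_comm u v]
    abel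

/-- For the image `X` of a `p`-form, `∑ γ_i X γ_i = (-1)^p (2N - 2p) X` by Euler's identity, while
each summand has the trace of `X`. Comparing the two forces the trace to vanish. -/
theorem trace_cliffordMap_formPart {p : ℕ} (hp : p ≠ 0) (ω : Polyform N) :
    Matrix.trace (cliffordMap N (formPart p ω)) = 0 := by
  set x := formPart p ω with hx
  have h1 : ∀ i, gamma i * cliffordMap N x * gamma i =
      (-1 : ℂ) ^ p • (cliffordMap N x - (2 : ℂ) • cliffordMap N
        (dx i * contr (Pi.single i 1) x)) := fun i => by
    rw [← gammaVec_single, gammaVec_mul_cliffordMap, cliffordMap_mul_gammaVec, ← map_smul,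
      ← map_sub, ← map_smul]
    congr 1
    rw [map_add, gradeInv_ι_mul, gradeInv_contr, hx, gradeInv_formPart, ← hx]
    simp only [map_add, map_neg, map_smul, contr_ι_mul, mul_add, mul_neg, mul_smul_comm]
    have hcc : contr (Pi.single i 1) (contr (Pi.single i 1) x) = 0 :=
      CliffordAlgebra.contractLeft_contractLeft (Q := (0 : QuadraticForm ℂ (Vec N))) _ x
    have hii : ι ℂ (Pi.single i 1 : Vec N) * (ι ℂ (Pi.single i 1 : Vec N) * x) = 0 := by
      rw [← mul_assoc, ι_sq_zero, zero_mul]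
    rw [hcc, hii]
    simp only [dx, single_dotProduct, Pi.single_eq_same, one_mul, one_smul]
    module
  have h2 : ∀ i, Matrix.trace (gamma i * cliffordMap N x * gamma i) =
      Matrix.trace (cliffordMap N x) := fun i => by
    rw [Matrix.trace_mul_comm, ← mul_assoc, gamma_sq, one_mul]
  have h3 : ∑ i : Fin (2 * N), Matrix.trace (gamma i * cliffordMap N x * gamma i) =
      (-1) ^ p * ((2 * N - 2 * p) * Matrix.trace (cliffordMap N x)) := by
    have h : ∑ i, Matrix.trace (cliffordMap N (dx i * contr (Pi.single i 1) x)) =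
        p * Matrix.trace (cliffordMap N x) := by
      rw [← Matrix.trace_sum, ← map_sum, hx, sum_dx_mul_contr, map_smul, Matrix.trace_smul,
        smul_eq_mul]
    simp only [h1, Matrix.trace_smul, Matrix.trace_sub, smul_eq_mul, ← Finset.mul_sum,
      Finset.sum_sub_distrib, h, Finset.sum_const, Finset.card_univ, Fintype.card_fin,
      nsmul_eq_mul]
    push_cast
    ring
  simp only [h2] at h3
  rw [Finset.sum_const, Finset.card_univ, Fintype.card_fin, nsmul_eq_mul] at h3
  -- For even `p` the comparison reads `p * tr X = 0`; for odd `p` it reads `(2N - p) * tr X = 0`,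
  -- and `p = 2N` is excluded by parity.
  rcases Nat.even_or_odd p with h | h
  · rw [h.neg_one_pow] at h3
    have : (p : ℂ) * Matrix.trace (cliffordMap N x) = 0 := by
      push_cast at h3
      linear_combination (1 / 2) * h3
    exact (mul_eq_zero.mp this).resolve_left (Nat.cast_ne_zero.mpr hp)
  · rw [h.neg_one_pow] at h3
    have : ((2 * N : ℂ) - p) * Matrix.trace (cliffordMap N x) = 0 := by
      push_cast at h3
      linear_combination (1 / 2) * h3
    refine (mul_eq_zero.mp this).resolve_left (sub_ne_zero.mpr ?_)
    norm_cast
    intro h'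
    rw [← h'] at h
    exact (Nat.not_odd_iff_even.mpr (even_two_mul N)) h

theorem trace_cliffordMap (ω : Polyform N) :
    Matrix.trace (cliffordMap N ω) = 2 ^ N * algebraMapInv ω := by
  have h0 : Matrix.trace (cliffordMap N (formPart 0 ω)) = 2 ^ N * algebraMapInv ω := by
    rw [formPart_zero_eq, cliffordMap_algebraMap, Algebra.algebraMap_eq_smul_one,
      Matrix.trace_smul, Matrix.trace_one]
    simp [mul_comm]
  obtain ⟨n, hn⟩ := sum_formPart ω
  rw [← h0]
  conv_lhs => rw [← hn, map_sum, Matrix.trace_sum]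
  rw [Finset.sum_eq_single 0]
  · exact fun p _ hp => trace_cliffordMap_formPart hp ω
  · intro h
    rw [Finset.mem_range, Nat.pos_iff_ne_zero, not_not] at h
    subst h
    rw [← hn]
    simp [formPart]

theorem contrList_gradeInv (l : List (Fin (2 * N))) (ω : Polyform N) :
    algebraMapInv (contrList l (gradeInv ω)) =
      (-1) ^ l.length * algebraMapInv (contrList l ω) := by
  induction l generalizing ω with
  | nil =>
    simp only [contrList, LinearMap.id_apply, List.length_nil, pow_zero, one_mul]
    apply (algebraMap_leftInverse (R := ℂ) (Vec N)).injective
    rw [← formPart_zero_eq, ← formPart_zero_eq, formPart_gradeInv, pow_zero, one_smul]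
  | cons i l ih =>
    simp only [contrList, LinearMap.comp_apply, List.length_cons, pow_succ]
    have h : contr (Pi.single i 1) (gradeInv ω) = -gradeInv (contr (Pi.single i 1) ω) := by
      rw [gradeInv_contr, neg_neg]
    rw [h, map_neg, map_neg, ih]
    ring

theorem contrList_dx_mul {j : Fin (2 * N)} {l : List (Fin (2 * N))} (hj : j ∉ l)
    (ω : Polyform N) : algebraMapInv (contrList l (dx j * ω)) = 0 := by
  induction l generalizing ω with
  | nil => simp [contrList, dx, algebraMapInv]
  | cons i l ih =>
    simp only [List.mem_cons, not_or] at hj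
    simp only [contrList, LinearMap.comp_apply]
    have h : contr (Pi.single i 1) (dx j * ω) = -(dx j * contr (Pi.single i 1) ω) := by
      rw [dx, contr_ι_mul]
      simp [Ne.symm hj.1]
    rw [h, map_neg, map_neg, ih hj.2, neg_zero]

/-- Cyclicity moves the first gamma matrix to the right of the form. Its wedge part drops out
because its index does not recur in the list, and its contraction part peels off one index. The
grade involution contributes `(-1)^|l|`, where `l` is the remaining list, and these signs add up to
the binomial exponent. -/
theorem trace_prod_gamma_mul_cliffordMap {l : List (Fin (2 * N))} (hl : l.Nodup)
    (ω : Polyform N) :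
    Matrix.trace ((l.map gamma).prod * cliffordMap N ω) =
      2 ^ N * (-1) ^ l.length.choose 2 * algebraMapInv (contrList l ω) := by
  induction l generalizing ω with
  | nil => simp [contrList, trace_cliffordMap]
  | cons j l ih =>
    obtain ⟨hj, hl⟩ := List.nodup_cons.mp hl
    rw [List.map_cons, List.prod_cons, mul_assoc, Matrix.trace_mul_comm, mul_assoc,
      ← gammaVec_single, cliffordMap_mul_gammaVec, ih hl, map_sub, map_sub,
      ← dx, contrList_dx_mul hj, zero_sub, ← map_neg, ← map_neg, ← gradeInv_contr,
      contrList_gradeInv, List.length_cons, Nat.choose_succ_succ' l.length 1,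
      Nat.choose_one_right, pow_add]
    simp only [contrList, LinearMap.comp_apply]
    ring

/-- The Fierz expansion: traces against products of gamma matrices extract the components of the
form. Repeated indices are harmless since their wedge product vanishes. -/
theorem sum_trace_smul_dx (p : ℕ) (ω : Polyform N) :
    ∑ f : Fin p → Fin (2 * N),
      Matrix.trace ((List.ofFn fun a => gamma (f a)).prod * cliffordMap N ω) •
        (List.ofFn fun a => dx (f a)).prod =
      (2 ^ N * (-1) ^ p.choose 2 * p.factorial : ℂ) • formPart p ω := by
  rw [mul_smul, ← sum_iterated_contr, Finset.smul_sum]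
  refine Finset.sum_congr rfl fun f _ => ?_
  by_cases hf : (List.ofFn f).Nodup
  · have h := trace_prod_gamma_mul_cliffordMap hf ω
    rw [List.map_ofFn, List.length_ofFn] at h
    rw [smul_smul, ← h]
    rfl
  · have h := prod_dx_eq_zero hf
    rw [List.map_ofFn] at h
    change (List.ofFn fun a => dx (f a)).prod = (0 : Polyform N) at h
    rw [h, smul_zero, smul_zero, smul_zero]

theorem cliffordMap_injective : Function.Injective (cliffordMap N) := by
  rw [← LinearMap.ker_eq_bot, LinearMap.ker_eq_bot']
  intro ω h
  apply ext_formPart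
  intro p
  have h' := sum_trace_smul_dx p ω
  simp only [h, mul_zero, Matrix.trace_zero, zero_smul, Finset.sum_const_zero] at h'
  rw [(smul_eq_zero.mp h'.symm).resolve_left]
  · exact (map_zero _).symm
  · exact mul_ne_zero (mul_ne_zero (by simp) (by simp))
      (Nat.cast_ne_zero.mpr p.factorial_ne_zero)

end Polyform

/-! ## Hodge duality -/

namespace Polyform

open ExteriorAlgebra

variable {N : ℕ}

theorem prod_dx_mem (l : List (Fin (2 * N))) :
    ((l.map dx).prod : Polyform N) ∈ ⋀[ℂ]^l.length (Vec N) := by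
  induction l with
  | nil => simp
  | cons i l ih => rw [List.map_cons, List.prod_cons]; exact ι_mul_mem _ ih

theorem volForm_mem : volForm N ∈ ⋀[ℂ]^(2 * N) (Vec N) := by
  have h := prod_dx_mem (List.finRange (2 * N))
  rwa [List.length_finRange] at h

theorem ι_mul_volForm (v : Vec N) : ι ℂ v * volForm N = 0 := by
  rw [← sum_smul_dx, Finset.sum_mul]
  refine Finset.sum_eq_zero fun i _ => ?_
  have h := prod_dx_eq_zero (l := i :: List.finRange (2 * N)) (by simp)
  rw [List.map_cons, List.prod_cons] at h
  rw [smul_mul_assoc, volForm, h, smul_zero]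

theorem cliffordMap_volForm :
    cliffordMap N (volForm N) = ((List.finRange (2 * N)).map gamma).prod :=
  cliffordMap_prod _ (List.nodup_finRange _)

theorem gradeInv_volForm : gradeInv (volForm N) = volForm N := by
  have h := gradeInv_formPart (2 * N) (volForm N)
  rwa [formPart_of_mem volForm_mem, if_pos rfl, (even_two_mul N).neg_one_pow, one_smul] at h

theorem contraction_ι_mul (u : Vec N) (ξ ψ : Polyform N) :
    contraction N (ι ℂ u * ξ) ψ = contr u (contraction N ξ ψ) := by
  rw [map_mul, Module.End.mul_apply, contraction, lift_ι_apply]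
  rfl

theorem contraction_algebraMap (r : ℂ) (ψ : Polyform N) :
    contraction N (algebraMap ℂ _ r) ψ = r • ψ := by
  rw [AlgHom.commutes, Module.algebraMap_end_apply]

/-- Moving `v ∧ ·` through the contractions one at a time costs a sign and a scalar product at each;
the scalar products assemble into `ι_v ξ`. -/
theorem ι_mul_contraction (v : Vec N) (ξ ψ : Polyform N) :
    ι ℂ v * contraction N ξ ψ =
      contraction N (gradeInv ξ) (ι ℂ v * ψ) + contraction N (contr v ξ) ψ := by
  induction ξ using induction_on with
  | scalar r =>
    rw [gradeInv.commutes, contr_algebraMap, map_zero, LinearMap.zero_apply, add_zero,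
      contraction_algebraMap, contraction_algebraMap, mul_smul_comm]
  | add x y hx hy => simp only [map_add, LinearMap.add_apply, mul_add, hx, hy]; abel
  | ι_mul u x hx =>
    have h : ∀ y : Polyform N, ι ℂ v * contr u y = (u ⬝ᵥ v) • y - contr u (ι ℂ v * y) :=
      fun y => by rw [contr_ι_mul]; abel
    rw [contraction_ι_mul, h, hx, gradeInv_ι_mul, contr_ι_mul]
    simp only [map_neg, map_sub, map_add, map_smul, LinearMap.neg_apply, LinearMap.sub_apply,
      LinearMap.smul_apply, contraction_ι_mul, dotProduct_comm v u]
    abel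

/-- Clifford multiplication by the volume element, on the right, is a contraction into it. -/
theorem cliffordMap_contraction_volForm (ξ : Polyform N) :
    cliffordMap N (contraction N ξ (volForm N)) =
      cliffordMap N ξ * cliffordMap N (volForm N) := by
  induction ξ using clifford_induction_on with
  | scalar r =>
    rw [contraction_algebraMap, cliffordMap_algebraMap, map_smul, Algebra.smul_def]
  | add x y hx hy => simp only [map_add, LinearMap.add_apply, hx, hy, add_mul]
  | vec_mul v x hx =>
    -- Because `v ∧ vol = 0`, wedging with `v` after contracting into `vol` is contracting with `ι_v
    -- x`. So wedge and contraction exchange roles, and their sum, Clifford multiplication, is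
    -- preserved.
    have h := ι_mul_contraction v x (volForm N)
    rw [ι_mul_volForm, map_zero, zero_add] at h
    rw [map_add, LinearMap.add_apply, contraction_ι_mul, ← h, ← gammaVec_mul_cliffordMap,
      mul_assoc, ← hx, gammaVec_mul_cliffordMap, add_comm]

theorem formPart_contraction_volForm {j p : ℕ} (h : j + p = 2 * N) (ξ : Polyform N) :
    formPart j (contraction N ξ (volForm N)) = contraction N (formPart p ξ) (volForm N) := by
  induction ξ using induction_on generalizing j p with
  | scalar r =>
    rw [contraction_algebraMap, formPart_smul, formPart_of_mem volForm_mem, formPart_algebraMap]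
    by_cases hp : p = 0
    · rw [if_pos hp, if_pos (by omega), contraction_algebraMap]
    · rw [if_neg hp, if_neg (by omega), smul_zero, map_zero, LinearMap.zero_apply]
  | add x y hx hy => simp only [map_add, LinearMap.add_apply, formPart_add, hx h, hy h]
  | ι_mul u x hx =>
    rw [contraction_ι_mul, formPart_contr]
    cases p with
    | zero =>
      rw [formPart_zero_ι_mul, formPart_eq_zero_of_lt (by omega), map_zero, map_zero,
        LinearMap.zero_apply]
    | succ p => rw [formPart_succ_ι_mul, contraction_ι_mul, hx (p := p) (by omega)]

theorem neg_one_pow_choose_two_mul_two (q : ℕ) : (-1 : ℂ) ^ (2 * q).choose 2 = (-1) ^ q := by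
  induction q with
  | zero => simp
  | succ q ih =>
    have h : (2 * (q + 1)).choose 2 = (2 * q).choose 2 + (2 * (2 * q) + 1) := by
      have h1 : (2 * q + 1 + 1).choose 2 = _ := Nat.choose_succ_succ' (2 * q + 1) 1
      have h2 : (2 * q + 1).choose 2 = _ := Nat.choose_succ_succ' (2 * q) 1
      norm_num only [Nat.choose_one_right] at h1 h2
      rw [show 2 * (q + 1) = 2 * q + 1 + 1 by ring]
      omega
    rw [h, pow_add, ih, pow_add, pow_mul, neg_one_sq, one_pow, one_mul, pow_one, pow_succ]

theorem rev_volForm : rev (volForm N) = (-1 : ℂ) ^ N • volForm N := by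
  have h := rev_formPart (2 * N) (volForm N)
  rwa [formPart_of_mem volForm_mem, if_pos rfl, neg_one_pow_choose_two_mul_two] at h

theorem hodgeStar_eq (ω : Polyform N) :
    hodgeStar ω = contraction N (rev ω) (volForm N) := rfl

theorem hodgeStar_smul (a : ℂ) (ω : Polyform N) : hodgeStar (a • ω) = a • hodgeStar ω := by
  rw [hodgeStar_eq, hodgeStar_eq, map_smul, map_smul, LinearMap.smul_apply]

/-- The star is contraction into the volume form after reversal, and reversal acts on degree `2q` by
`(-1)^q`. -/
theorem hodgeStar_formPart {Φ : Polyform N} {a : ℂ}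
    (hΦ : contraction N Φ (volForm N) = a • Φ) {q : ℕ} (hq : q ≤ N) :
    hodgeStar (formPart (2 * q) Φ) = ((-1) ^ q * a) • formPart (2 * (N - q)) Φ := by
  rw [hodgeStar_eq, rev_formPart, map_smul, LinearMap.smul_apply,
    ← formPart_contraction_volForm (j := 2 * (N - q)) (by omega), hΦ, formPart_smul, smul_smul,
    neg_one_pow_choose_two_mul_two]

/-- A form that is an eigenvector of Hodge duality is determined by its lower half. -/
theorem eq_zero_of_formPart_eq_zero {Φ : Polyform N} {a : ℂ} (ha : a ≠ 0)
    (hΦ : contraction N Φ (volForm N) = a • Φ) (h : ∀ p ≤ N, formPart p Φ = 0) : Φ = 0 := by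
  apply ext_formPart
  intro p
  rw [show formPart p (0 : Polyform N) = 0 from map_zero _]
  rcases le_or_gt p N with hp | hp
  · exact h p hp
  rcases lt_or_ge (2 * N) p with hp' | hp'
  · exact formPart_eq_zero_of_lt hp' Φ
  · have h1 := formPart_contraction_volForm (j := p) (p := 2 * N - p) (by omega) Φ
    rw [h _ (by omega), map_zero, LinearMap.zero_apply, hΦ, formPart_smul] at h1
    exact (smul_eq_zero.mp h1).resolve_left ha

theorem formPart_eq_zero_of_odd {Φ : Polyform N} (h : gradeInv Φ = Φ) {p : ℕ} (hp : Odd p) :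
    formPart p Φ = 0 := by
  have h' := formPart_gradeInv p Φ
  rw [h, hp.neg_one_pow, neg_one_smul] at h'
  have : (2 : ℂ) • formPart p Φ = 0 := by rw [two_smul]; exact add_eq_zero_iff_eq_neg.mpr h'
  exact (smul_eq_zero.mp this).resolve_left two_ne_zero

/-! ## Powers of a two-form -/

variable {M : Matrix (Fin (2 * N)) (Fin (2 * N)) ℂ}

theorem twoForm_eq (M : Matrix (Fin (2 * N)) (Fin (2 * N)) ℂ) :
    twoForm M = (1 / 2 : ℂ) • ∑ i, dx i * ι ℂ (M i) := by
  rw [twoForm]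
  congr 1
  refine Finset.sum_congr rfl fun i _ => ?_
  rw [← sum_smul_dx, Finset.mul_sum]
  simp only [mul_smul_comm]

theorem twoForm_mem (M : Matrix (Fin (2 * N)) (Fin (2 * N)) ℂ) :
    twoForm M ∈ ⋀[ℂ]^2 (Vec N) := by
  rw [twoForm_eq]
  exact Submodule.smul_mem _ _ (Submodule.sum_mem _ fun i _ => ι_mul_mem _ (ι_mem _))

theorem twoForm_pow_mem (M : Matrix (Fin (2 * N)) (Fin (2 * N)) ℂ) (q : ℕ) :
    twoForm M ^ q ∈ ⋀[ℂ]^(2 * q) (Vec N) := by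
  have h := SetLike.pow_mem_graded (A := fun n : ℕ => ⋀[ℂ]^n (Vec N)) q (twoForm_mem M)
  rwa [smul_eq_mul, mul_comm q 2] at h

theorem twoForm_pow_eq_zero_of_lt (M : Matrix (Fin (2 * N)) (Fin (2 * N)) ℂ) {q : ℕ}
    (hq : N < q) : twoForm M ^ q = 0 := by
  have h := formPart_of_mem (twoForm_pow_mem M q) (2 * q)
  rw [if_pos rfl, formPart_eq_zero_of_lt (by omega)] at h
  exact h.symm

theorem twoForm_mul_ι (u : Vec N) : twoForm M * ι ℂ u = ι ℂ u * twoForm M := by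
  have h := gradeInv_formPart 2 (twoForm M)
  rw [formPart_of_mem (twoForm_mem M), if_pos rfl, neg_one_sq, one_smul] at h
  rw [mul_ι, h]

theorem contr_twoForm (hM : Mᵀ = -M) (v : Vec N) :
    contr v (twoForm M) = -ι ℂ (M *ᵥ v) := by
  have h1 : ∑ i, v i • ι ℂ (M i) = ι ℂ (v ᵥ* M) := by
    simp only [← map_smul, ← map_sum]
    congr 1
    ext j
    simp [Matrix.vecMul, dotProduct]
  have h2 : v ᵥ* M = -(M *ᵥ v) := by
    rw [← Matrix.mulVec_transpose, hM, Matrix.neg_mulVec]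
  rw [twoForm_eq]
  simp only [map_smul, map_sum, dx, contr_ι_mul, contr_ι, Finset.sum_sub_distrib,
    dotProduct_single, mul_one, h1, h2, map_neg]
  have h3 : ∑ i, ι ℂ (Pi.single i 1 : Vec N) * algebraMap ℂ (Polyform N) (v ⬝ᵥ M i) =
      ι ℂ (M *ᵥ v) := by
    rw [← sum_smul_dx]
    refine Finset.sum_congr rfl fun i _ => ?_
    rw [← Algebra.commutes, ← Algebra.smul_def, dotProduct_comm]
    rfl
  rw [h3]
  module

/-- Contraction is an antiderivation and the two-form is even, so no sign arises in front of the
second term. -/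
theorem contr_twoForm_mul (hM : Mᵀ = -M) (v : Vec N) (ω : Polyform N) :
    contr v (twoForm M * ω) = -(ι ℂ (M *ᵥ v) * ω) + twoForm M * contr v ω := by
  have h : contr v (twoForm M * ω) = contr v (twoForm M) * ω + twoForm M * contr v ω := by
    rw [twoForm_eq]
    simp only [smul_mul_assoc, map_smul, Finset.sum_mul, map_sum, mul_assoc, dx, contr_ι_mul,
      contr_ι, ← smul_add, ← Finset.sum_add_distrib]
    congr 1
    refine Finset.sum_congr rfl fun i _ => ?_
    rw [sub_mul, mul_assoc, smul_mul_assoc, mul_sub, ← Algebra.smul_def]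
    abel
  rw [h, contr_twoForm hM, neg_mul]

theorem contr_twoForm_pow (hM : Mᵀ = -M) (v : Vec N) (q : ℕ) :
    contr v (twoForm M ^ (q + 1)) = -((q + 1 : ℂ) • (ι ℂ (M *ᵥ v) * twoForm M ^ q)) := by
  induction q with
  | zero => simp [contr_twoForm hM]
  | succ q ih =>
    rw [pow_succ', contr_twoForm_mul hM, ih, mul_neg, mul_smul_comm, ← mul_assoc, twoForm_mul_ι,
      mul_assoc, ← pow_succ']
    push_cast
    module

theorem twoForm_pow_succ_eq_zero {m : ℕ} (h : ∀ i, ι ℂ (M i) * twoForm M ^ m = 0) :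
    twoForm M ^ (m + 1) = 0 := by
  rw [pow_succ']
  nth_rewrite 1 [twoForm_eq]
  simp [Finset.sum_mul, mul_assoc, h]

/-- A vector contracting a nonzero power of a two-form to zero is in the kernel of the two-form. -/
theorem mulVec_eq_zero_of_contr_pow (hM : Mᵀ = -M) {v : Vec N} {m : ℕ}
    (hne : twoForm M ^ (m + 1) ≠ 0) (h : contr v (twoForm M ^ (m + 1)) = 0) : M *ᵥ v = 0 := by
  set u := M *ᵥ v with hu
  have hu0 : ι ℂ u * twoForm M ^ m = 0 := by
    rw [contr_twoForm_pow hM, neg_eq_zero] at h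
    exact (smul_eq_zero.mp h).resolve_left (by exact_mod_cast m.succ_ne_zero)
  -- Contracting `u ∧ M^m = 0` with `x` gives `(x ⬝ᵥ u) M^m = u ∧ ι_x M^m`. Multiplied by `M`, the
  -- right side becomes proportional to `u ∧ (M x) ∧ M^m`, which vanishes, whereas `M^(m+1) ≠ 0`.
  have key : ∀ x : Vec N, x ⬝ᵥ u = 0 := by
    intro x
    have h1 := contr_ι_mul x u (twoForm M ^ m)
    rw [hu0, map_zero] at h1
    have h2 : ι ℂ u * contr x (twoForm M ^ m) * twoForm M = 0 := by
      cases m with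
      | zero =>
        have : contr x (1 : Polyform N) = 0 := by
          rw [← map_one (algebraMap ℂ (Polyform N)), contr_algebraMap]
        simp [this]
      | succ m =>
        rw [contr_twoForm_pow hM, mul_neg, mul_smul_comm, ι_mul_ι_mul, smul_neg, neg_neg,
          smul_mul_assoc, mul_assoc, mul_assoc, ← pow_succ, hu0, mul_zero, smul_zero]
    have h3 : (x ⬝ᵥ u) • twoForm M ^ (m + 1) = 0 := by
      rw [pow_succ, ← smul_mul_assoc, sub_eq_zero.mp h1.symm, h2]
    exact (smul_eq_zero.mp h3).resolve_right hne
  exact dotProduct_eq_zero u fun x => by rw [dotProduct_comm, key]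

theorem formPart_exp (M : Matrix (Fin (2 * N)) (Fin (2 * N)) ℂ) (a : ℂ) (p : ℕ) :
    formPart p (IsNilpotent.exp (a • twoForm M)) =
      if Even p then (a ^ (p / 2) / ((p / 2).factorial : ℂ)) • twoForm M ^ (p / 2) else 0 := by
  -- Exponent `N + 1` already suffices; the extra `p` keeps the index `p / 2` within the truncated
  -- exponential sum.
  have hnil : (a • twoForm M) ^ (N + 1 + p) = 0 := by
    rw [smul_pow, twoForm_pow_eq_zero_of_lt M (by omega), smul_zero]
  have hq : ∀ i : ℕ, ((i.factorial : ℚ)⁻¹ • (a • twoForm M) ^ i : Polyform N) =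
      (a ^ i / (i.factorial : ℂ)) • twoForm M ^ i := fun i => by
    rw [smul_pow, ← Rat.cast_smul_eq_qsmul ℂ, smul_smul]
    congr 1
    push_cast
    ring
  rw [IsNilpotent.exp_eq_sum hnil, formPart_sum]
  simp only [hq, formPart_smul, formPart_of_mem (twoForm_pow_mem M _)]
  split_ifs with h
  · rw [Finset.sum_eq_single (p / 2)]
    · rw [if_pos (by have := Nat.two_mul_div_two_of_even h; omega)]
    · intro i _ hi
      rw [if_neg (by omega), smul_zero]
    · intro h'
      exact absurd (Finset.mem_range.mpr (by omega)) h'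
  · refine Finset.sum_eq_zero fun i _ => ?_
    rw [if_neg (fun h' => h ⟨i, by omega⟩), smul_zero]

end Polyform

/-! ## Pure spinors and their bispinors -/

namespace PureSpinor

open ExteriorAlgebra Polyform

variable {N : ℕ}

theorem mem_annihilator {η : Spinor N} {v : Vec N} :
    v ∈ annihilator η ↔ gammaVec N v *ᵥ η = 0 := Iff.rfl

theorem gammaVec_mulVec (v : Vec N) (η : Spinor N) :
    gammaVec N v *ᵥ η = ∑ i, v i • (gamma i *ᵥ η) := by
  simp [gammaVec, Fintype.linearCombination_apply, Matrix.sum_mulVec, Matrix.smul_mulVec]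

theorem gammaVec_mul_add_swap (u v : Vec N) :
    gammaVec N u * gammaVec N v + gammaVec N v * gammaVec N u = (2 * (u ⬝ᵥ v)) • 1 := by
  rw [← cliffordMap_ι v, gammaVec_mul_cliffordMap, cliffordMap_ι v, ← cliffordMap_ι u,
    gammaVec_mul_cliffordMap, ← map_add, contr_ι, contr_ι, dotProduct_comm v u]
  have h := ι_add_mul_swap (R := ℂ) u v
  rw [add_add_add_comm, h, zero_add, ← map_add, cliffordMap_algebraMap, ← two_mul,
    Algebra.algebraMap_eq_smul_one]

theorem IsPure.ne_zero (hN : 0 < N) {η : Spinor N} (h : IsPure η) : η ≠ 0 := by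
  rintro rfl
  have htop : annihilator (0 : Spinor N) = ⊤ := by
    ext v
    simp [mem_annihilator]
  rw [IsPure, htop, finrank_top, Module.finrank_fin_fun] at h
  omega

/-- The anticommutator of `u` and `v` kills `η`, yet it is the scalar `2 (u ⬝ᵥ v)`. -/
theorem dotProduct_eq_zero_of_mem {η : Spinor N} (hη : η ≠ 0) {u v : Vec N}
    (hu : u ∈ annihilator η) (hv : v ∈ annihilator η) : u ⬝ᵥ v = 0 := by
  have h := congrArg (· *ᵥ η) (gammaVec_mul_add_swap u v)
  simp only [Matrix.add_mulVec, ← Matrix.mulVec_mulVec, mem_annihilator.mp hu,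
    mem_annihilator.mp hv, Matrix.mulVec_zero, add_zero, Matrix.smul_mulVec,
    Matrix.one_mulVec] at h
  have h' := (smul_eq_zero.mp h.symm).resolve_right hη
  exact (mul_eq_zero.mp h').resolve_left two_ne_zero

/-- The annihilator of a pure spinor is a maximal isotropic subspace. -/
theorem mem_annihilator_of_orthogonal (hN : 0 < N) {η : Spinor N} (h : IsPure η) {u : Vec N}
    (hu : ∀ v ∈ annihilator η, v ⬝ᵥ u = 0) : u ∈ annihilator η := by
  set D : LinearMap.BilinForm ℂ (Vec N) := Matrix.toBilin' 1 with hD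
  have hD_apply : ∀ x y, D x y = x ⬝ᵥ y := fun x y => by
    rw [hD, Matrix.toBilin'_apply', Matrix.one_mulVec]
  have hnd : D.Nondegenerate :=
    LinearMap.BilinForm.nondegenerate_toBilin'_iff_det_ne_zero.mpr (by simp)
  have hle : annihilator η ≤ D.orthogonal (annihilator η) := fun x hx y hy => by
    change D y x = 0
    rw [hD_apply]
    exact dotProduct_eq_zero_of_mem (IsPure.ne_zero hN h) hy hx
  -- The orthogonal complement has dimension `2N - N = N`, the dimension of the annihilator.
  have heq := Submodule.eq_of_le_of_finrank_eq hle (by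
    rw [LinearMap.BilinForm.finrank_orthogonal hnd, Module.finrank_fin_fun, h]
    omega)
  rw [heq]
  intro v hv
  change D v u = 0
  rw [hD_apply]
  exact hu v hv

theorem mul_bispinor (B : SpinMat N) (η₁ η₂ : Spinor N) (X : SpinMat N) :
    X * bispinor B η₁ η₂ = bispinor B (X *ᵥ η₁) η₂ :=
  Matrix.mul_vecMulVec _ _ _

theorem bispinor_mul_of_intertwines {B X Y : SpinMat N} (h : B * X = Yᵀ * B)
    (η₁ η₂ : Spinor N) : bispinor B η₁ η₂ * X = bispinor B η₁ (Y *ᵥ η₂) := by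
  rw [bispinor, Matrix.vecMulVec_mul, Matrix.vecMul_vecMul, h, ← Matrix.vecMul_vecMul,
    Matrix.vecMul_transpose, bispinor]

theorem bispinor_ne_zero {B : SpinMat N} (hB : IsUnit B) {η₁ η₂ : Spinor N} (h₁ : η₁ ≠ 0)
    (h₂ : η₂ ≠ 0) : bispinor B η₁ η₂ ≠ 0 := by
  refine Matrix.vecMulVec_ne_zero h₁ fun h => h₂ ?_
  exact Matrix.vecMul_injective_of_isUnit hB (h.trans (Matrix.zero_vecMul B).symm)

theorem intertwiner_mul_gammaVec {B : SpinMat N} {ε : ℂ}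
    (h : ∀ i, B * gamma i = ε • ((gamma i)ᵀ * B)) (v : Vec N) :
    B * gammaVec N v = (ε • gammaVec N v)ᵀ * B := by
  simp only [gammaVec, Fintype.linearCombination_apply, Finset.mul_sum, Finset.smul_sum,
    Matrix.transpose_sum, Finset.sum_mul, Matrix.transpose_smul, mul_smul_comm, smul_mul_assoc, h]
  exact Finset.sum_congr rfl fun i _ => smul_comm _ _ _

theorem intertwiner_mul_prod {B : SpinMat N} {ε : ℂ}
    (h : ∀ i, B * gamma i = ε • ((gamma i)ᵀ * B)) (l : List (Fin (2 * N))) :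
    B * (l.map gamma).prod = ε ^ l.length • ((l.reverse.map gamma).prodᵀ * B) := by
  induction l with
  | nil => simp
  | cons i l ih =>
    rw [List.map_cons, List.prod_cons, ← mul_assoc, h, smul_mul_assoc, mul_assoc, ih,
      List.reverse_cons, List.map_append, List.prod_append, Matrix.transpose_mul, mul_smul_comm,
      smul_smul, List.length_cons, pow_succ', mul_assoc]
    simp

theorem rev_prod_dx (l : List (Fin (2 * N))) :
    rev ((l.map dx).prod) = (l.reverse.map dx).prod := by
  induction l with
  | nil =>
    have h := rev_algebraMap (N := N) 1
    rwa [map_one] at h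
  | cons i l ih =>
    rw [List.map_cons, List.prod_cons, rev_mul, ih, List.reverse_cons, List.map_append,
      List.prod_append]
    simp [dx, rev_ι]

/-- Transposition reverses the product of all gamma matrices, which costs `(-1)^N`; the sign `ε`
enters to the even power `2N` and disappears. -/
theorem intertwiner_mul_volume {B : SpinMat N} (hB : IsIntertwiner B) :
    B * cliffordMap N (volForm N) = ((-1 : ℂ) ^ N • cliffordMap N (volForm N))ᵀ * B := by
  obtain ⟨-, ε, hε, h⟩ := hB
  have hε2 : ε ^ (2 * N) = 1 := by
    rw [pow_mul]
    rcases hε with rfl | rfl <;> simp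
  rw [← map_smul, ← rev_volForm, volForm, rev_prod_dx, cliffordMap_prod _ (List.nodup_finRange _),
    cliffordMap_prod _ (List.nodup_reverse.mpr (List.nodup_finRange _)), intertwiner_mul_prod h,
    List.length_finRange, hε2, one_smul]

theorem isUnit_prod_gamma (l : List (Fin (2 * N))) : IsUnit (l.map gamma).prod := by
  induction l with
  | nil => simp
  | cons i l ih =>
    rw [List.map_cons, List.prod_cons]
    exact (IsUnit.of_mul_eq_one _ (gamma_sq i)).mul ih

/-! ### The polyform of a bispinor: annihilation, duality, parity and bilinears -/

section Bispinor

variable {B : SpinMat N} {I I' : Spinor N} {c : ℂ} {Φ : Polyform N}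

theorem bispinor_left {v : Vec N} (hΦ : cliffordMap N Φ = bispinor B I I')
    (hv : v ∈ annihilator I) : ι ℂ v * Φ + contr v Φ = 0 := by
  apply cliffordMap_injective
  rw [← gammaVec_mul_cliffordMap, hΦ, mul_bispinor, mem_annihilator.mp hv, map_zero]
  exact Matrix.zero_vecMulVec _

theorem bispinor_right {v : Vec N} (hB : IsIntertwiner B)
    (hΦ : cliffordMap N Φ = bispinor B I I') (hv : v ∈ annihilator I') :
    ι ℂ v * gradeInv Φ - contr v (gradeInv Φ) = 0 := by
  obtain ⟨-, ε, -, h⟩ := hB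
  apply cliffordMap_injective
  rw [← cliffordMap_mul_gammaVec, hΦ,
    bispinor_mul_of_intertwines (intertwiner_mul_gammaVec h v), Matrix.smul_mulVec,
    mem_annihilator.mp hv, map_zero, smul_zero, bispinor, Matrix.zero_vecMul]
  exact Matrix.vecMulVec_zero _

theorem volume_mulVec {a : ℂ} (hc : c ≠ 0) {η : Spinor N}
    (h : chiralityMat N c *ᵥ η = a • η) :
    cliffordMap N (volForm N) *ᵥ η = (c⁻¹ * a) • η := by
  rw [chiralityMat, ← cliffordMap_volForm, Matrix.smul_mulVec] at h
  rw [mul_smul, ← h, smul_smul, inv_mul_cancel₀ hc, one_smul]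

theorem volume_mul_bispinor (hc : c ≠ 0) (hI : chiralityMat N c *ᵥ I = I)
    (hΦ : cliffordMap N Φ = bispinor B I I') :
    cliffordMap N (volForm N) * cliffordMap N Φ = c⁻¹ • cliffordMap N Φ := by
  rw [hΦ, mul_bispinor, volume_mulVec hc (a := 1) (by rw [hI, one_smul]), mul_one]
  exact Matrix.smul_vecMulVec _ _ _

/-- The chirality sign `(-1)^N` of `I'` cancels the one from transposing the volume element, so left
and right multiplication by the volume element have the same eigenvalue `c⁻¹`. -/
theorem bispinor_mul_volume (hB : IsIntertwiner B) (hc : c ≠ 0)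
    (hI' : chiralityMat N c *ᵥ I' = (-1 : ℂ) ^ N • I')
    (hΦ : cliffordMap N Φ = bispinor B I I') :
    cliffordMap N Φ * cliffordMap N (volForm N) = c⁻¹ • cliffordMap N Φ := by
  rw [hΦ, bispinor_mul_of_intertwines (intertwiner_mul_volume hB), Matrix.smul_mulVec,
    volume_mulVec hc hI', smul_smul, mul_comm, mul_assoc, ← mul_pow]
  simp [bispinor, Matrix.smul_vecMul, Matrix.vecMulVec_smul]

theorem contraction_volForm_bispinor (hB : IsIntertwiner B) (hc : c ≠ 0)
    (hI' : chiralityMat N c *ᵥ I' = (-1 : ℂ) ^ N • I')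
    (hΦ : cliffordMap N Φ = bispinor B I I') :
    contraction N Φ (volForm N) = c⁻¹ • Φ := by
  apply cliffordMap_injective
  rw [cliffordMap_contraction_volForm, bispinor_mul_volume hB hc hI' hΦ, map_smul]

/-- The volume element anticommutes with every vector because the dimension is even. -/
theorem cliffordMap_gradeInv_mul_volume (ω : Polyform N) :
    cliffordMap N (gradeInv ω) * cliffordMap N (volForm N) =
      cliffordMap N (volForm N) * cliffordMap N ω := by
  induction ω using clifford_induction_on with
  | scalar r => rw [gradeInv.commutes, cliffordMap_algebraMap, Algebra.commutes]
  | add x y hx hy => simp only [map_add, add_mul, mul_add, hx, hy]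
  | vec_mul v x hx =>
    have h : cliffordMap N (volForm N) * gammaVec N v =
        -(gammaVec N v * cliffordMap N (volForm N)) := by
      rw [cliffordMap_mul_gammaVec, gammaVec_mul_cliffordMap, gradeInv_volForm, ι_mul_volForm,
        zero_sub, zero_add, map_neg]
    rw [← gammaVec_mul_cliffordMap, ← mul_assoc, h, map_add, gradeInv_ι_mul, gradeInv_contr,
      ← neg_add, map_neg, ← gammaVec_mul_cliffordMap, neg_mul, neg_mul, mul_assoc, hx, mul_assoc]

/-- Equal left and right eigenvalues mean that the bispinor commutes with the volume element. That
element is invertible and implements the grade involution, so the form is even. -/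
theorem gradeInv_bispinor (hB : IsIntertwiner B) (hc : c ≠ 0)
    (hI : chiralityMat N c *ᵥ I = I)
    (hI' : chiralityMat N c *ᵥ I' = (-1 : ℂ) ^ N • I')
    (hΦ : cliffordMap N Φ = bispinor B I I') : gradeInv Φ = Φ := by
  apply cliffordMap_injective
  have hu : IsUnit (cliffordMap N (volForm N)) := by
    rw [cliffordMap_volForm]
    exact isUnit_prod_gamma _
  apply hu.mul_left_injective
  simp only
  rw [cliffordMap_gradeInv_mul_volume, volume_mul_bispinor hc hI hΦ,
    bispinor_mul_volume hB hc hI' hΦ]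

/-- The trace of `X` times the bispinor is the pairing of `I'` with `X I`, so the bilinears are the
trace components of the Fierz expansion. -/
theorem spinorBilinear_eq (hΦ : cliffordMap N Φ = bispinor B I I') (q : ℕ) :
    spinorBilinear B (2 * q) I' I = ((-1) ^ q * 2 ^ N : ℂ) • formPart (2 * q) Φ := by
  have h := sum_trace_smul_dx (2 * q) Φ
  have htr : ∀ X : SpinMat N, Matrix.trace (X * cliffordMap N Φ) = spinorInner B I' (X *ᵥ I) :=
    fun X => by
      rw [hΦ, mul_bispinor, bispinor, Matrix.trace_vecMulVec, dotProduct_comm]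
      rfl
  simp only [htr] at h
  rw [spinorBilinear, h, smul_smul, neg_one_pow_choose_two_mul_two]
  congr 1
  have := Nat.cast_ne_zero (R := ℂ).mpr (2 * q).factorial_ne_zero
  field_simp

end Bispinor

end PureSpinor

/-! ### The matrix `M` and the two annihilators -/

namespace PureSpinor

open ExteriorAlgebra Polyform

variable {N k : ℕ} {B : SpinMat N} {I I' : Spinor N} {c S : ℂ} {Φ : Polyform N}
  {M : Matrix (Fin (2 * N)) (Fin (2 * N)) ℂ}

/-- The two spinors annihilate complementary eigenspaces of `M`, or, for `S = 0`, subspaces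
containing the image of `M` and contained in its kernel. -/
structure Polarizes (I I' : Spinor N) (S : ℂ) (M : Matrix (Fin (2 * N)) (Fin (2 * N)) ℂ) :
    Prop where
  eigen_left : ∀ v ∈ annihilator I, M *ᵥ v = S • v
  eigen_right : ∀ v ∈ annihilator I', M *ᵥ v = -(S • v)
  image_left : ∀ x, S • x + M *ᵥ x ∈ annihilator I
  image_right : ∀ x, S • x - M *ᵥ x ∈ annihilator I'

/-- The image of `S + M` lies in the annihilator of `I`, where `M` acts as `S`; hence `(M - S)(M +
S) = 0`, also when `S = 0`. -/
theorem Polarizes.mul_self (h : Polarizes I I' S M) : M * M = S ^ 2 • 1 := by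
  rw [Matrix.ext_iff_mulVec]
  intro x
  have hx := h.eigen_left _ (h.image_left x)
  rw [Matrix.mulVec_add, Matrix.mulVec_smul, smul_add, smul_smul, ← pow_two, add_comm] at hx
  rw [← Matrix.mulVec_mulVec, Matrix.smul_mulVec, Matrix.one_mulVec]
  exact add_right_cancel hx

theorem row_eq_mulVec (hM : Mᵀ = -M) (i : Fin (2 * N)) : M i = -(M *ᵥ Pi.single i 1) := by
  ext j
  have h : M i j = -M j i := congrFun (congrFun hM j) i
  simp [h]

theorem Polarizes.sum_left (h : Polarizes I I' S M) (hM : Mᵀ = -M) (i : Fin (2 * N)) :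
    ∑ j, (S • (1 : Matrix (Fin (2 * N)) (Fin (2 * N)) ℂ) - M) i j • (gamma j *ᵥ I) = 0 := by
  rw [← gammaVec_mulVec, ← mem_annihilator]
  have hi := h.image_left (Pi.single i 1)
  rw [← neg_neg (M *ᵥ _), ← row_eq_mulVec hM, ← sub_eq_add_neg] at hi
  convert hi using 1
  ext j
  simp [Matrix.one_apply, Pi.single_apply, eq_comm]

theorem Polarizes.sum_right (h : Polarizes I I' S M) (hM : Mᵀ = -M) (i : Fin (2 * N)) :
    ∑ j, (S • (1 : Matrix (Fin (2 * N)) (Fin (2 * N)) ℂ) + M) i j • (gamma j *ᵥ I') = 0 := by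
  rw [← gammaVec_mulVec, ← mem_annihilator]
  have hi := h.image_right (Pi.single i 1)
  rw [sub_eq_add_neg, ← row_eq_mulVec hM] at hi
  convert hi using 1
  ext j
  simp [Matrix.one_apply, Pi.single_apply, eq_comm]

/-- The degree-one part of the equation is `S^(k+1) v - s S^k (M v) = 0`. The sign `s` covers both
spinors at once. -/
theorem mulVec_eq_smul_of_formPart (hM : Mᵀ = -M) (hS : S ≠ 0)
    (h0 : formPart 0 Φ = algebraMap ℂ _ (S ^ (k + 1))) (h2 : formPart 2 Φ = S ^ k • twoForm M)
    {v : Vec N} {s : ℂ} (hv : ι ℂ v * Φ + s • contr v Φ = 0) : S • v = s • (M *ᵥ v) := by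
  have h := congrArg (formPart 1) hv
  rw [formPart_add, formPart_smul, formPart_contr, formPart_succ_ι_mul, h0, h2, map_smul,
    contr_twoForm hM, ← Algebra.commutes, ← Algebra.smul_def, show formPart 1 (0 : Polyform N) = 0
      from map_zero _, smul_comm, pow_succ, mul_smul, ← smul_add, smul_neg, ← sub_eq_add_neg,
    ← map_smul, ← map_smul, ← map_sub] at h
  have h' := (smul_eq_zero.mp h).resolve_left (pow_ne_zero k hS)
  exact sub_eq_zero.mp (ι_eq_zero_iff _ |>.mp h')

theorem polarizes_of_ne_zero (hI : IsPure I) (hI' : IsPure I') (hM : Mᵀ = -M) (hS : S ≠ 0)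
    (hl : ∀ v ∈ annihilator I, ι ℂ v * Φ + contr v Φ = 0)
    (hr : ∀ v ∈ annihilator I', ι ℂ v * Φ - contr v Φ = 0)
    (h0 : formPart 0 Φ = algebraMap ℂ _ (S ^ (k + 1))) (h2 : formPart 2 Φ = S ^ k • twoForm M) :
    Polarizes I I' S M ∧ annihilator I ⊔ annihilator I' = ⊤ := by
  have el : ∀ v ∈ annihilator I, M *ᵥ v = S • v := fun v hv => by
    have h := mulVec_eq_smul_of_formPart (s := 1) hM hS h0 h2 (by rw [one_smul, hl v hv])
    rw [h, one_smul]
  have er : ∀ v ∈ annihilator I', M *ᵥ v = -(S • v) := fun v hv => by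
    have h := mulVec_eq_smul_of_formPart (s := -1) hM hS h0 h2
      (by rw [neg_one_smul, ← sub_eq_add_neg, hr v hv])
    rw [h, neg_one_smul, neg_neg]
  have htop : annihilator I ⊔ annihilator I' = ⊤ := by
    apply Submodule.eq_top_of_disjoint
    · rw [hI, hI', Module.finrank_fin_fun, two_mul]
    · rw [Submodule.disjoint_def]
      intro v hv hv'
      have h := el v hv
      rw [er v hv', neg_eq_iff_add_eq_zero, ← two_smul ℂ, smul_smul] at h
      exact (smul_eq_zero.mp h).resolve_left (mul_ne_zero two_ne_zero hS)
  have hsplit : ∀ x : Vec N, ∃ a ∈ annihilator I, ∃ b ∈ annihilator I', a + b = x := fun x =>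
    Submodule.mem_sup.mp (htop ▸ Submodule.mem_top)
  refine ⟨⟨el, er, fun x => ?_, fun x => ?_⟩, htop⟩
  · obtain ⟨a, ha, b, hb, rfl⟩ := hsplit x
    rw [Matrix.mulVec_add, el a ha, er b hb]
    -- For `x = a + b`, the vector `S x + M x` is `2 S a`, since the `b` parts cancel.
    convert Submodule.smul_mem _ (2 * S) ha using 1
    module
  · obtain ⟨a, ha, b, hb, rfl⟩ := hsplit x
    rw [Matrix.mulVec_add, el a ha, er b hb]
    convert Submodule.smul_mem _ (2 * S) hb using 1
    module

/-- On each annihilator `ι_v Φ = ∓ v ∧ Φ` and `M v = ± S v`, so both cases take this common form,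
which extends linearly to the span. -/
theorem contr_eq_of_polarizes (h : Polarizes I I' S M)
    (htop : annihilator I ⊔ annihilator I' = ⊤)
    (hl : ∀ v ∈ annihilator I, ι ℂ v * Φ + contr v Φ = 0)
    (hr : ∀ v ∈ annihilator I', ι ℂ v * Φ - contr v Φ = 0) (v : Vec N) :
    S • contr v Φ = -(ι ℂ (M *ᵥ v) * Φ) := by
  obtain ⟨a, ha, b, hb, rfl⟩ := Submodule.mem_sup.mp
    (htop ▸ Submodule.mem_top : v ∈ annihilator I ⊔ annihilator I')
  have h1 := eq_neg_of_add_eq_zero_right (hl a ha)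
  have h2 := (sub_eq_zero.mp (hr b hb)).symm
  rw [Matrix.mulVec_add, h.eigen_left a ha, h.eigen_right b hb, map_add, LinearMap.add_apply,
    h1, h2, map_add, map_neg, map_smul, map_smul, add_mul, neg_mul, smul_mul_assoc,
    smul_mul_assoc]
  module

/-- The even components of a form are the exponential series, scaled by `S ^ (k + 1)`. -/
theorem formPart_two_mul_of_contr (hM : Mᵀ = -M) (hS : S ≠ 0)
    (h0 : formPart 0 Φ = algebraMap ℂ _ (S ^ (k + 1)))
    (hc : ∀ v, S • contr v Φ = -(ι ℂ (M *ᵥ v) * Φ)) (q : ℕ) :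
    formPart (2 * q) Φ = (S ^ (k + 1) * (S⁻¹ ^ q / (q.factorial : ℂ))) • twoForm M ^ q := by
  induction q with
  | zero => simp [h0, Algebra.algebraMap_eq_smul_one]
  | succ q ih =>
    have hmem : formPart (2 * (q + 1)) (twoForm M ^ (q + 1)) = twoForm M ^ (q + 1) := by
      rw [formPart_of_mem (twoForm_pow_mem M _), if_pos rfl]
    rw [← hmem, ← formPart_smul]
    refine formPart_eq_of_contr (by omega) fun v => ?_
    rw [formPart_smul, hmem]
    apply smul_right_injective _ hS
    -- In degree `2q + 1` the equation expresses the contraction of the component of degree `2q + 2`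
    -- through the component of degree `2q`.
    have h := congrArg (formPart (2 * q + 1)) (hc v)
    rw [formPart_smul, formPart_contr, ← neg_mul, ← map_neg, formPart_succ_ι_mul, ih] at h
    change S • contr v (formPart (2 * q + 1 + 1) Φ) = _
    rw [h, map_smul, contr_twoForm_pow hM, map_neg, neg_mul, mul_smul_comm, smul_neg, smul_smul]
    change _ = S • _
    rw [smul_neg, smul_smul]
    congr 2
    have hf := Nat.cast_ne_zero (R := ℂ).mpr q.factorial_ne_zero
    have hq : (q : ℂ) + 1 ≠ 0 := by exact_mod_cast q.succ_ne_zero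
    rw [Nat.factorial_succ, inv_pow, inv_pow, pow_succ S q]
    push_cast
    field_simp

theorem eq_exp_iff_formPart (Φ : Polyform N) (M : Matrix (Fin (2 * N)) (Fin (2 * N)) ℂ)
    (k : ℕ) (S : ℂ) (hodd : ∀ p, Odd p → formPart p Φ = 0) :
    Φ = S ^ (k + 1) • IsNilpotent.exp (S⁻¹ • twoForm M) ↔
      ∀ q : ℕ, formPart (2 * q) Φ =
        (S ^ (k + 1) * (S⁻¹ ^ q / (q.factorial : ℂ))) • twoForm M ^ q := by
  constructor
  · intro h q
    rw [h, formPart_smul, formPart_exp, if_pos (even_two_mul q), smul_smul,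
      Nat.mul_div_cancel_left q two_pos]
  · intro h
    apply ext_formPart
    intro p
    rw [formPart_smul, formPart_exp]
    split_ifs with hp
    · obtain ⟨q, rfl⟩ := even_iff_two_dvd.mp hp
      rw [h, smul_smul, Nat.mul_div_cancel_left q two_pos]
    · rw [smul_zero, hodd p (Nat.not_even_iff_odd.mp hp)]

/-- With `Φ_{2k}` absent, the equations in degree `2k + 1` say that annihilating vectors contract
`∧^{k+1} M` to zero, so they lie in the kernel of `M`. The image of the antisymmetric `M` is
orthogonal to its kernel, hence lies in both maximal isotropic annihilators. -/
theorem polarizes_of_eq_zero (hN : 0 < N) (hI : IsPure I) (hI' : IsPure I') (hM : Mᵀ = -M)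
    (hl : ∀ v ∈ annihilator I, ι ℂ v * Φ + contr v Φ = 0)
    (hr : ∀ v ∈ annihilator I', ι ℂ v * Φ - contr v Φ = 0)
    (hlow : formPart (2 * k) Φ = 0) {a : ℂ}
    (htop : formPart (2 * (k + 1)) Φ = a • twoForm M ^ (k + 1))
    (hne : formPart (2 * (k + 1)) Φ ≠ 0) :
    Polarizes I I' 0 M ∧ twoForm M ^ (k + 2) = 0 := by
  rw [htop] at hne
  obtain ⟨ha, hne'⟩ := smul_ne_zero_iff.mp hne
  have low : ∀ (v : Vec N) (s : ℂ), s ≠ 0 → ι ℂ v * Φ + s • contr v Φ = 0 → M *ᵥ v = 0 := by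
    intro v s hs h
    have h' := congrArg (formPart (2 * k + 1)) h
    rw [formPart_add, formPart_succ_ι_mul, hlow, mul_zero, zero_add, formPart_smul,
      formPart_contr, show 2 * k + 1 + 1 = 2 * (k + 1) by ring, htop, map_smul, smul_smul,
      show formPart (2 * k + 1) (0 : Polyform N) = 0 from map_zero _] at h'
    exact mulVec_eq_zero_of_contr_pow hM hne'
      ((smul_eq_zero.mp h').resolve_left (mul_ne_zero hs ha))
  have kl : ∀ v ∈ annihilator I, M *ᵥ v = 0 := fun v hv =>
    low v 1 one_ne_zero (by rw [one_smul, hl v hv])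
  have kr : ∀ v ∈ annihilator I', M *ᵥ v = 0 := fun v hv =>
    low v (-1) (by simp) (by rw [neg_one_smul, ← sub_eq_add_neg, hr v hv])
  have orth : ∀ v x : Vec N, M *ᵥ v = 0 → v ⬝ᵥ (M *ᵥ x) = 0 := fun v x hv => by
    rw [Matrix.dotProduct_mulVec, ← Matrix.mulVec_transpose, hM, Matrix.neg_mulVec, hv, neg_zero,
      zero_dotProduct]
  have il : ∀ x, M *ᵥ x ∈ annihilator I := fun x =>
    mem_annihilator_of_orthogonal hN hI fun v hv => orth v x (kl v hv)
  have ir : ∀ x, M *ᵥ x ∈ annihilator I' := fun x =>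
    mem_annihilator_of_orthogonal hN hI' fun v hv => orth v x (kr v hv)
  refine ⟨⟨fun v hv => by rw [kl v hv, zero_smul], fun v hv => by rw [kr v hv, zero_smul, neg_zero],
    fun x => by rw [zero_smul, zero_add]; exact il x,
    fun x => by rw [zero_smul, zero_sub]; exact Submodule.neg_mem _ (ir x)⟩, ?_⟩
  refine twoForm_pow_succ_eq_zero fun i => ?_
  rw [row_eq_mulVec hM, map_neg, neg_mul, neg_eq_zero]
  set u := M *ᵥ Pi.single i 1
  -- As `u` annihilates both spinors, adding the two equations cancels the contractions.
  have h2 : ι ℂ u * Φ = 0 := by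
    have h : (2 : ℂ) • (ι ℂ u * Φ) = 0 := by
      have := congrArg₂ (· + ·) (hl u (il _)) (hr u (ir _))
      simp only [add_zero] at this
      rw [two_smul, ← this]
      abel
    exact (smul_eq_zero.mp h).resolve_left two_ne_zero
  have h3 := congrArg (formPart (2 * (k + 1) + 1)) h2
  rw [formPart_succ_ι_mul, htop, mul_smul_comm,
    show formPart (2 * (k + 1) + 1) (0 : Polyform N) = 0 from map_zero _] at h3
  exact (smul_eq_zero.mp h3).resolve_left ha

theorem formType_eq_zero (h : formPart 0 Φ ≠ 0) : formType Φ = 0 :=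
  le_antisymm (iInf₂_le_of_le 0 h le_rfl) zero_le

end PureSpinor

/-! ### The theorem: the cases of vanishing and nonvanishing `S` -/

open ExteriorAlgebra Polyform PureSpinor in
theorem mainTheorem1 (N k : ℕ) (hN : 0 < N) (hNk : N ≤ 2 * k + 3)
    (B : SpinMat N) (hB : IsIntertwiner B)
    (c : ℂ) (hc : c ^ 2 = (-1) ^ N)
    (I I' : Spinor N) (hI : IsPure I) (hI' : IsPure I')
    (hIchi : chiralityMat N c *ᵥ I = I)
    (hIchi' : chiralityMat N c *ᵥ I' = (-1 : ℂ) ^ N • I')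
    (S : ℂ) (M : Matrix (Fin (2 * N)) (Fin (2 * N)) ℂ) (hM : Mᵀ = -M)
    (Φ : Polyform N) (hΦ : cliffordMap N Φ = bispinor B I I') :
    -- for `S ≠ 0` the identity is fixed by its zero-form and two-form components
    (S ≠ 0 →
      (Φ = S ^ (k + 1) • IsNilpotent.exp (S⁻¹ • twoForm M) ↔
        formPart 0 Φ = algebraMap ℂ (Polyform N) (S ^ (k + 1)) ∧
        formPart 2 Φ = S ^ k • twoForm M)) ∧
    -- the identity implies all relations; at `S = 0` it is read degree by degree,
    -- in the degrees where its right-hand side is polynomial in `S`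
    ((S ≠ 0 → Φ = S ^ (k + 1) • IsNilpotent.exp (S⁻¹ • twoForm M)) →
      (S = 0 → ∀ q ≤ k + 1,
        formPart (2 * q) Φ = (S ^ (k + 1 - q) / (q.factorial : ℂ)) • twoForm M ^ q) →
      M * M = S ^ 2 • (1 : Matrix (Fin (2 * N)) (Fin (2 * N)) ℂ) ∧
      (∀ i, ∑ j, (S • (1 : Matrix (Fin (2 * N)) (Fin (2 * N)) ℂ) - M) i j •
        (gamma j *ᵥ I) = 0) ∧
      (∀ i, ∑ j, (S • (1 : Matrix (Fin (2 * N)) (Fin (2 * N)) ℂ) + M) i j •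
        (gamma j *ᵥ I') = 0) ∧
      -- Hodge duality, with negative powers of `S` moved to the other side
      (∀ q ≤ N,
        (N ≤ 2 * q →
          ((q.factorial : ℂ)⁻¹) • hodgeStar (twoForm M ^ q) =
            (c⁻¹ * (-1) ^ q * S ^ (2 * q - N) / ((N - q).factorial : ℂ)) •
              twoForm M ^ (N - q)) ∧
        (2 * q ≤ N →
          (S ^ (N - 2 * q) / (q.factorial : ℂ)) • hodgeStar (twoForm M ^ q) =
            (c⁻¹ * (-1) ^ q / ((N - q).factorial : ℂ)) • twoForm M ^ (N - q))) ∧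
      -- spinor bilinears in every degree, with negative powers of `S` moved to the other side
      (∀ q : ℕ,
        (q ≤ k + 1 →
          spinorBilinear B (2 * q) I' I =
            ((-1) ^ q * 2 ^ N * S ^ (k + 1 - q) / (q.factorial : ℂ)) • twoForm M ^ q) ∧
        (k + 1 ≤ q →
          S ^ (q - (k + 1)) • spinorBilinear B (2 * q) I' I =
            ((-1) ^ q * 2 ^ N / (q.factorial : ℂ)) • twoForm M ^ q)) ∧
      (S ≠ 0 → formType Φ = 0)) := by
  have hc0 : c ≠ 0 := by
    rintro rfl
    exact pow_ne_zero N (by norm_num : (-1 : ℂ) ≠ 0) (by rw [← hc]; simp)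
  have hinv := gradeInv_bispinor hB hc0 hIchi hIchi' hΦ
  have hodd : ∀ p, Odd p → formPart p Φ = 0 := fun p hp => formPart_eq_zero_of_odd hinv hp
  have hstar := contraction_volForm_bispinor hB hc0 hIchi' hΦ
  have hl : ∀ v ∈ annihilator I, ι ℂ v * Φ + contr v Φ = 0 := fun v hv => bispinor_left hΦ hv
  have hr : ∀ v ∈ annihilator I', ι ℂ v * Φ - contr v Φ = 0 := fun v hv => by
    have h := bispinor_right hB hΦ hv
    rwa [hinv] at h
  have hne : Φ ≠ 0 := by
    rintro rfl
    rw [map_zero] at hΦ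
    exact bispinor_ne_zero hB.1 (IsPure.ne_zero hN hI) (IsPure.ne_zero hN hI') hΦ.symm
  have hexp := eq_exp_iff_formPart Φ M k S hodd
  have hfac : ∀ q : ℕ, (q.factorial : ℂ) ≠ 0 := fun q => Nat.cast_ne_zero.mpr q.factorial_ne_zero
  have low : S ≠ 0 → (∀ q : ℕ, formPart (2 * q) Φ =
        (S ^ (k + 1) * (S⁻¹ ^ q / (q.factorial : ℂ))) • twoForm M ^ q) →
      formPart 0 Φ = algebraMap ℂ (Polyform N) (S ^ (k + 1)) ∧
        formPart 2 Φ = S ^ k • twoForm M := fun hS h => by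
    constructor
    · simpa [Algebra.algebraMap_eq_smul_one] using h 0
    · have h1 := h 1
      rw [mul_one, pow_one, pow_one] at h1
      rw [h1]
      congr 1
      simp [pow_succ, hS]
  refine ⟨fun hS => ?_, fun h1 h2 => ?_⟩
  · rw [hexp]
    refine ⟨low hS, fun ⟨h0, h2⟩ => ?_⟩
    obtain ⟨hpol, htop⟩ := polarizes_of_ne_zero hI hI' hM hS hl hr h0 h2
    exact formPart_two_mul_of_contr hM hS h0 (contr_eq_of_polarizes hpol htop hl hr)
  rcases eq_or_ne S 0 with rfl | hS
  · have hlow : ∀ q ≤ k, formPart (2 * q) Φ = 0 := fun q hq => by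
      rw [h2 rfl q (by omega), zero_pow (by omega), zero_div, zero_smul]
    have htop : formPart (2 * (k + 1)) Φ =
        ((k + 1).factorial : ℂ)⁻¹ • twoForm M ^ (k + 1) := by
      rw [h2 rfl _ le_rfl, Nat.sub_self, pow_zero, one_div]
    -- The bound `N ≤ 2k+3` is what makes these degrees cover the lower half that determines `Φ`;
    -- the odd degree `2k+3` vanishes by parity.
    have hlow' : ∀ p, p ≠ 2 * (k + 1) → p ≤ 2 * k + 3 → formPart p Φ = 0 := fun p hp hp' => by
      rcases Nat.even_or_odd' p with ⟨q, rfl | rfl⟩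
      · exact hlow q (by omega)
      · exact hodd _ ⟨q, rfl⟩
    have hne' : formPart (2 * (k + 1)) Φ ≠ 0 := fun h =>
      hne (eq_zero_of_formPart_eq_zero (inv_ne_zero hc0) hstar fun p hp => by
        by_cases hpk : p = 2 * (k + 1)
        · rw [hpk, h]
        · exact hlow' p hpk (by omega))
    -- Otherwise the only possible nonzero component lies above the middle degree, and duality would
    -- give `Φ = 0`. So `N` is `2k+2` or `2k+3`.
    have hkN : 2 * (k + 1) ≤ N := by
      by_contra hkN
      exact hne (eq_zero_of_formPart_eq_zero (inv_ne_zero hc0) hstar fun p hp =>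
        hlow' p (by omega) (by omega))
    obtain ⟨hpol, hpow⟩ := polarizes_of_eq_zero hN hI hI' hM hl hr (hlow k le_rfl) htop hne'
    have hpow' : ∀ q, k + 2 ≤ q → twoForm M ^ q = 0 := fun q hq => pow_eq_zero_of_le hq hpow
    have star0 : hodgeStar (0 : Polyform N) = 0 := by
      simpa using hodgeStar_smul 0 (0 : Polyform N)
    -- At `S = 0` only the middle degree carries a nontrivial Hodge relation. Off the middle, the
    -- power of `S` vanishes on one side and the power of `M`, of exponent at least `k + 2`, on the
    -- other.
    have hmid : ∀ q, N = 2 * q → (q.factorial : ℂ)⁻¹ • hodgeStar (twoForm M ^ q) =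
        (c⁻¹ * (-1) ^ q / ((N - q).factorial : ℂ)) • twoForm M ^ (N - q) := fun q hq => by
      obtain rfl : q = k + 1 := by omega
      have h := hodgeStar_formPart hstar (q := k + 1) (by omega)
      rw [show N - (k + 1) = k + 1 by omega] at h ⊢
      rw [htop, hodgeStar_smul, smul_smul] at h
      rw [h]
      congr 1
      ring
    refine ⟨hpol.mul_self, hpol.sum_left hM, hpol.sum_right hM, fun q hq => ⟨fun hq' => ?_,
      fun hq' => ?_⟩, fun q => ⟨fun hq => ?_, fun hq => ?_⟩, fun h => absurd rfl h⟩
    · rcases hq'.eq_or_lt with h | h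
      · rw [hmid q h, show 2 * q - N = 0 by omega, pow_zero, mul_one]
      · rw [hpow' q (by omega), star0, zero_pow (by omega)]
        simp
    · rcases hq'.eq_or_lt with h | h
      · rw [← hmid q h.symm, show N - 2 * q = 0 by omega, pow_zero, one_div]
      · rw [hpow' (N - q) (by omega), zero_pow (by omega)]
        simp
    · rw [spinorBilinear_eq hΦ, h2 rfl q hq, smul_smul]
      congr 1
      ring
    · rcases hq.eq_or_lt with rfl | h
      · rw [spinorBilinear_eq hΦ, htop, Nat.sub_self, pow_zero, one_smul, smul_smul]
        rfl
      · rw [hpow' q (by omega), zero_pow (by omega), zero_smul, smul_zero]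
  · have hform := hexp.mp (h1 hS)
    obtain ⟨h0, h2'⟩ := low hS hform
    obtain ⟨hpol, -⟩ := polarizes_of_ne_zero hI hI' hM hS hl hr h0 h2'
    have hhodge : ∀ q ≤ N, ((q.factorial : ℂ)⁻¹) • hodgeStar (twoForm M ^ q) =
        (c⁻¹ * (-1) ^ q * (S ^ q / S ^ (N - q)) / ((N - q).factorial : ℂ)) •
          twoForm M ^ (N - q) := fun q hq => by
      have h := hodgeStar_formPart hstar hq
      rw [hform, hform, hodgeStar_smul, smul_smul] at h
      -- This factor clears the coefficient `S^(k+1-q)` of the component of degree `2q`, leaving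
      -- only `1/q!` on the left.
      have h' := congrArg ((S ^ q / S ^ (k + 1)) • ·) h
      simp only [smul_smul, inv_pow] at h'
      have hSk := pow_ne_zero (k + 1) hS
      convert h' using 2
      · have := hfac q
        field_simp
      · have := hfac (N - q)
        field_simp
    refine ⟨hpol.mul_self, hpol.sum_left hM, hpol.sum_right hM, fun q hq => ⟨fun hq' => ?_,
      fun hq' => ?_⟩, fun q => ⟨fun hq => ?_, fun hq => ?_⟩, fun _ => formType_eq_zero ?_⟩
    · rw [hhodge q hq]
      congr 2
      rw [show S ^ q = S ^ (N - q) * S ^ (2 * q - N) by rw [← pow_add]; congr 1; omega]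
      field_simp
    · rw [div_eq_mul_inv, mul_smul, hhodge q hq, smul_smul]
      congr 1
      rw [show S ^ (N - q) = S ^ q * S ^ (N - 2 * q) by rw [← pow_add]; congr 1; omega]
      field_simp
    · rw [spinorBilinear_eq hΦ, hform, smul_smul, inv_pow]
      congr 1
      rw [show S ^ (k + 1) = S ^ q * S ^ (k + 1 - q) by rw [← pow_add]; congr 1; omega]
      field_simp
    · rw [spinorBilinear_eq hΦ, hform, smul_smul, smul_smul]
      congr 1
      have hq' : S⁻¹ ^ q = (S ^ (k + 1) * S ^ (q - (k + 1)))⁻¹ := by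
        rw [← pow_add, inv_pow]; congr 2; omega
      rw [hq']
      field_simp
    · rw [h0]
      exact fun h => pow_ne_zero (k + 1) hS
        ((algebraMap_leftInverse (R := ℂ) (Vec N)).injective (h.trans (map_zero _).symm))
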